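/- Let $m\ge 1$, let $w=(w_\alpha)_{\alpha\in[m]}$ be nonnegative real weights with $|w|=\max_{\alpha\in[m]}w_\alpha$, and let $d=(d_\alpha)_{\alpha\in[m]}$ be integer thresholds. For a random vector $M=(M_\alpha)_{\alpha\in[m]}$ of nonnegative integer counts put $$Y_{ge}=\sum_{\alpha=1}^m w_\alpha \mathbf 1(M_\alpha\ge d_\alpha),\qquad Y_{ne}=\sum_{\alpha=1}^m w_\alpha \mathbf 1(M_\alpha\neq d_\alpha).$$ For a random variable $Y$ and reals $\mu,c>0$, consider the following concentration inequalities: $$P(Y-\mu\le -t)\le \exp\Big(-\frac{t^2}{2c\mu}\Big)\quad\text{for all } t>0,$$ $$P(Y-\mu\ge t)\le \exp\Big(-\frac{t^2}{2c\mu+ct}\Big)\quad\text{for all } t>0,$$ $$P(Y-\mu\ge t)\le \Big(\frac{\mu}{\mu+t}\Big)^{(t+\mu)/c}e^{t/c}\quad\text{for all } t\ge 0,$$ $$P(Y-\mu\le t)\le \Big(\frac{\mu}{\mu+t}\Big)^{(t+\mu)/c}e^{t/c}\quad\text{for all } -\mu\le t\le 0,$$ $$P(Y-\mu\ge t)\le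 \exp\Big(-\frac{t^2}{2c\mu+2ct/3}\Big)\quad\text{for all } t>0,$$ where at $t=-\mu$ the right-hand side of the fourth inequality is read as $e^{-\mu/c}$. In each of the following two models, $EY_{ge}=\mu_{ge}$ and $EY_{ne}=\mu_{ne}$ with the values $\mu_{ge},\mu_{ne}$ given below; if $\mu_{ge}>0$, then all the inequalities hold for $Y=Y_{ge}$, $\mu=\mu_{ge}$, $c=|w|$, and if $\mu_{ne}>0$, then all of them hold for $Y=Y_{ne}$, $\mu=\mu_{ne}$, $c=2|w|$. 1. Multinomial occupancy. Here $n\ge 0$ balls are placed independently into $m$ urns, the location $L_j$ of ball $j$ being urn $\alpha$ with probability $p_{\alpha,j}$, and $M_\alpha=\sum_{j=1}^n\mathbf 1(L_j=\alpha)$. The means are $$\mu_{ge}=\sum_{\alpha=1}^m w_\alpha\sum_{k=d_\alpha}^{n} q_{eq}(k,p_\alpha),\qquad \mu_{ne}=\sum_{\alpha=1}^m w_\alpha\big(1-q_{eq}(d_\alpha,p_\alpha)\big),$$ where $p_\alpha=(p_{\alpha,j})_{j\in[n]}$ and $q_{eq}(k,p)=\sum_{s\subset[n],\,|s|=k}\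 \prod_{j\in s}p_j\prod_{j\notin s}(1-p_j)$. 2. Multivariate hypergeometric sampling. An urn contains $n=\sum_{\alpha}n_\alpha$ balls, $n_\alpha\geq 1$ of which have color $\alpha\in[m]$; a set of $s$ distinct balls, $0\le s\le n$, is drawn uniformly at random (without replacement), and $M_\alpha$ is the number of balls of color $\alpha$ drawn. The means are $$\mu_{ge}=\sum_{\alpha=1}^m w_\alpha\sum_{j\ge d_\alpha} q(j;n_\alpha,s,n),\qquad \mu_{ne}=\sum_{\alpha=1}^m w_\alpha\sum_{j\ne d_\alpha} q(j;n_\alpha,s,n),$$ where $q(j;k,\ell,i)=\binom{k}{j}\binom{i-k}{\ell-j}\big/\binom{i}{\ell}$, and $q(j;k,\ell,i)=0$ when these binomial coefficients are not defined. -/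

import Mathlib

open MeasureTheory ProbabilityTheory

noncomputable section

namespace Occupancy

/-- The weighted number `Y_ge = ∑ w_α 1(M_α ≥ d_α)` of components of the count vector `M` that
are at least their threshold. -/
def Yge {Ω : Type*} {m : ℕ} (w : Fin m → ℝ) (d : Fin m → ℤ) (M : Fin m → Ω → ℕ) (ω : Ω) : ℝ :=
  ∑ α, w α * (if d α ≤ (M α ω : ℤ) then 1 else 0)

/-- The weighted number `Y_ne = ∑ w_α 1(M_α ≠ d_α)` of components of the count vector `M` that
differ from their threshold. -/
def Yne {Ω : Type*} {m : ℕ} (w : Fin m → ℝ) (d : Fin m → ℤ) (M : Fin m → Ω → ℕ) (ω : Ω) : ℝ :=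
  ∑ α, w α * (if (M α ω : ℤ) ≠ d α then 1 else 0)

/-- The maximal weight `|w| = max_α w_α`. -/
def maxWeight {m : ℕ} (w : Fin m → ℝ) : ℝ := ⨆ α, w α

/-- The concentration inequalities for `Y` around `μ` with constant `c`: the sub-Gaussian lower
tail, the sub-exponential upper tail, the two sub-Poisson tails, and the Bernstein upper tail.
At `t = -μ` the sub-Poisson bound reads `(μ / 0) ^ 0 * exp (-μ / c) = exp (-μ / c)`, which is its
limit as `t` decreases to `-μ`. -/
structure ConcentrationBounds {Ω : Type*} [MeasurableSpace Ω] (P : Measure Ω)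
    (Y : Ω → ℝ) (μ c : ℝ) : Prop where
  lower : ∀ t : ℝ, 0 < t →
    P.real {ω | Y ω - μ ≤ -t} ≤ Real.exp (-(t ^ 2 / (2 * c * μ)))
  upper : ∀ t : ℝ, 0 < t →
    P.real {ω | t ≤ Y ω - μ} ≤ Real.exp (-(t ^ 2 / (2 * c * μ + c * t)))
  poisson_upper : ∀ t : ℝ, 0 ≤ t →
    P.real {ω | t ≤ Y ω - μ} ≤ (μ / (μ + t)) ^ ((t + μ) / c) * Real.exp (t / c)
  poisson_lower : ∀ t : ℝ, -μ ≤ t → t ≤ 0 →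
    P.real {ω | Y ω - μ ≤ t} ≤ (μ / (μ + t)) ^ ((t + μ) / c) * Real.exp (t / c)
  bernstein_upper : ∀ t : ℝ, 0 < t →
    P.real {ω | t ≤ Y ω - μ} ≤ Real.exp (-(t ^ 2 / (2 * c * μ + 2 * c * t / 3)))

/-! ### Multinomial occupancy -/

/-- `n` balls are placed independently into `m` urns; `L j` is the location of ball `j`, and it
is urn `α` with probability `p α j`. -/
structure IsMultinomialOccupancy {Ω : Type*} [MeasurableSpace Ω] (P : Measure Ω) {m n : ℕ}
    (p : Fin m → Fin n → ℝ) (L : Fin n → Ω → Fin m) : Prop where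
  measurable : ∀ j, Measurable (L j)
  indep : iIndepFun L P
  law : ∀ α j, P.real {ω | L j ω = α} = p α j

/-- The number of balls in urn `α`. -/
def urnCount {Ω : Type*} {m n : ℕ} (L : Fin n → Ω → Fin m) (α : Fin m) (ω : Ω) : ℕ :=
  (Finset.univ.filter fun j => L j ω = α).card

/-- The Poisson binomial point probability: the probability that exactly `k` of `n` independent
Bernoulli variables with success probabilities `p j` are equal to one. -/
def pbEq {n : ℕ} (k : ℤ) (p : Fin n → ℝ) : ℝ :=
  ∑ s ∈ Finset.univ.filter (fun s : Finset (Fin n) => (s.card : ℤ) = k),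
    (∏ j ∈ s, p j) * ∏ j ∈ sᶜ, (1 - p j)

/-- The Poisson binomial tail probability. -/
def pbGe {n : ℕ} (d : ℤ) (p : Fin n → ℝ) : ℝ := ∑ k ∈ Finset.Icc d (n : ℤ), pbEq k p

/-- The Poisson binomial probability of differing from `d`. -/
def pbNe {n : ℕ} (d : ℤ) (p : Fin n → ℝ) : ℝ := 1 - pbEq d p

/-- The mean of `Y_ge` in the multinomial model. -/
def multinomialMeanGe {m n : ℕ} (w : Fin m → ℝ) (d : Fin m → ℤ) (p : Fin m → Fin n → ℝ) : ℝ :=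
  ∑ α, w α * pbGe (d α) (p α)

/-- The mean of `Y_ne` in the multinomial model. -/
def multinomialMeanNe {m n : ℕ} (w : Fin m → ℝ) (d : Fin m → ℤ) (p : Fin m → Fin n → ℝ) : ℝ :=
  ∑ α, w α * pbNe (d α) (p α)

/-! ### Multivariate hypergeometric sampling -/

/-- The balls of an urn that holds `N α` balls of each color `α`; the first component of a ball is
its color. -/
abbrev Ball {m : ℕ} (N : Fin m → ℕ) : Type := Σ α : Fin m, Fin (N α)

/-- `S` is a uniformly random set of `s` distinct balls, that is, a sample of size `s` taken
without replacement from an urn that holds `N α > 0` balls of each color `α`. -/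
structure IsHypergeometricSample {Ω : Type*} [MeasurableSpace Ω] (P : Measure Ω) {m : ℕ}
    (N : Fin m → ℕ) (s : ℕ) (S : Ω → Finset (Ball N)) : Prop where
  pos : ∀ α, 0 < N α
  size_le : s ≤ ∑ α, N α
  measurable : ∀ A, MeasurableSet {ω | S ω = A}
  law : ∀ A : Finset (Ball N), A.card = s →
    P.real {ω | S ω = A} = 1 / ((∑ α, N α).choose s : ℝ)

/-- The number of balls of color `α` in the sample. -/
def colorCount {Ω : Type*} {m : ℕ} {N : Fin m → ℕ} (S : Ω → Finset (Ball N)) (α : Fin m)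
    (ω : Ω) : ℕ :=
  ((S ω).filter fun b => b.1 = α).card

/-- The hypergeometric point probability
`q(j; k, l, i) = (k choose j) (i - k choose l - j) / (i choose l)`, with value `0` when a binomial
coefficient is undefined (the other out-of-range cases vanish by the value of `Nat.choose`). -/
def hyperQ (j k l i : ℕ) : ℝ :=
  if j ≤ l ∧ k ≤ i then
    (k.choose j : ℝ) * ((i - k).choose (l - j) : ℝ) / (i.choose l : ℝ)
  else 0

/-- The mean of `Y_ge` in the hypergeometric model (`hyperQ` vanishes for `j > s`). -/
def hyperMeanGe {m : ℕ} (w : Fin m → ℝ) (d : Fin m → ℤ) (N : Fin m → ℕ) (s : ℕ) : ℝ :=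
  ∑ α, w α * ∑ j ∈ (Finset.range (s + 1)).filter (fun j : ℕ => d α ≤ (j : ℤ)),
    hyperQ j (N α) s (∑ β, N β)

/-- The mean of `Y_ne` in the hypergeometric model (`hyperQ` vanishes for `j > s`). -/
def hyperMeanNe {m : ℕ} (w : Fin m → ℝ) (d : Fin m → ℤ) (N : Fin m → ℕ) (s : ℕ) : ℝ :=
  ∑ α, w α * ∑ j ∈ (Finset.range (s + 1)).filter (fun j : ℕ => (j : ℤ) ≠ d α),
    hyperQ j (N α) s (∑ β, N β)

end Occupancy

end

open MeasureTheory ProbabilityTheory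

noncomputable section

namespace Occupancy

/-!
Write `Y = ∑ w_α 1(A_α)` and `μ = E Y`. If, for every `α`, the law of `Y` conditioned on `A_α` is
stochastically dominated by the law of `Y + c`, then `E (Y e^{θY}) ≤ μ e^{cθ} E e^{θY}` for `θ ≥ 0`,
and the reverse holds for `θ ≤ 0`. This is a differential inequality for the moment generating
function; integrating it gives `E e^{θY} ≤ exp (μ (e^{cθ} - 1) / c)`, and all the tail bounds
follow by Chernoff's method.

For the domination, fix `α` and let `R` be the set of placed, or drawn, balls whose urn, or color,
is not `α`. Given its cardinality, `R` is a conditioned Bernoulli set, so by log-concavity of the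
cardinality laws it grows stochastically, one ball at a time, as the cardinality grows. Conditioning
on `M_α ≥ d_α` makes `R` smaller, which lowers every `M_β` with `β ≠ α`: the only term of `Y` that
can increase is that of `α`, so `c = |w|`. Conditioning on `M_α ≠ d_α` moves probability mass
between neighbouring cardinalities only, and adding a single ball to `R` affects at most two terms
of `Y`, so `c = 2|w|`.
-/

/-! ### Sub-Poisson moment generating functions -/

lemma exp_neg_le_quadratic {x : ℝ} (hx : 0 ≤ x) : Real.exp (-x) ≤ 1 - x + x ^ 2 / 2 := by
  have hsq : 1 ≤ (1 - x + x ^ 2 / 2) * (1 + x + x ^ 2 / 2) := by nlinarith [sq_nonneg (x ^ 2)]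
  have hpos : 0 ≤ 1 - x + x ^ 2 / 2 := by nlinarith [sq_nonneg (x - 1)]
  rw [Real.exp_neg, inv_le_iff_one_le_mul₀ (Real.exp_pos x)]
  exact hsq.trans (mul_le_mul_of_nonneg_left (Real.quadratic_le_exp_of_nonneg hx) hpos)

lemma exp_mul_two_sub_le {x : ℝ} (hx : 0 ≤ x) : Real.exp x * (2 - x) ≤ 2 + x := by
  rcases lt_or_ge x 2 with h2 | h2
  · have hpos : 0 < 2 - x := sub_pos.2 h2
    have hlog : x ≤ Real.log ((2 + x) / (2 - x)) := by
      convert Real.le_log_one_add_of_nonneg (x := 2 * x / (2 - x)) (by positivity) using 1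
      · field_simp
        ring
      · congr 1
        field_simp
        ring
    rwa [Real.le_log_iff_exp_le (by positivity), le_div_iff₀ hpos] at hlog
  · nlinarith [Real.exp_pos x]

lemma exp_mul_one_sub_third_le {x : ℝ} (hx : 0 ≤ x) :
    Real.exp x * (1 - x / 3) ≤ 1 + 2 * x / 3 + x ^ 2 / 6 := by
  have hderiv (u : ℝ) : HasDerivAt
      (fun u : ℝ => 1 + 2 * u / 3 + u ^ 2 / 6 - Real.exp u * (1 - u / 3))
      ((2 + u - Real.exp u * (2 - u)) / 3) u := by
    have h := (((((hasDerivAt_id u).const_mul 2).div_const 3).const_add 1).add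
      (((hasDerivAt_id u).pow 2).div_const 6)).sub
      ((Real.hasDerivAt_exp u).mul (((hasDerivAt_id u).div_const 3).const_sub 1))
    refine h.congr_deriv ?_
    simp only [id_eq, Nat.cast_ofNat]
    ring
  have hmono : MonotoneOn (fun u : ℝ => 1 + 2 * u / 3 + u ^ 2 / 6 - Real.exp u * (1 - u / 3))
      (Set.Ici 0) := by
    refine monotoneOn_of_hasDerivWithinAt_nonneg (convex_Ici 0)
      (fun u _ => (hderiv u).continuousAt.continuousWithinAt)
      (fun u _ => (hderiv u).hasDerivWithinAt) fun u hu => ?_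
    have := exp_mul_two_sub_le (interior_subset hu)
    linarith
  have h := hmono Set.self_mem_Ici hx hx
  norm_num at h
  linarith

section SubPoisson

variable {Ω : Type*} [MeasurableSpace Ω] {P : Measure Ω} {Y : Ω → ℝ} {μ c : ℝ}

/-- `Y` has a sub-Poisson moment generating function with mean parameter `μ` and scale `c`: it is
at most the one of `c` times a Poisson variable of mean `μ / c`. -/
structure HasSubPoissonMGF (Y : Ω → ℝ) (μ c : ℝ) (P : Measure Ω) : Prop where
  integrable_exp_mul : ∀ θ, Integrable (fun ω => Real.exp (θ * Y ω)) P
  mgf_le : ∀ θ, mgf Y P θ ≤ Real.exp (μ / c * (Real.exp (c * θ) - 1))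

namespace HasSubPoissonMGF

section Chernoff

variable [IsFiniteMeasure P]

lemma measureReal_ge_le (h : HasSubPoissonMGF Y μ c P) (hc : 0 < c) (t : ℝ) {x : ℝ} (hx : 0 ≤ x) :
    P.real {ω | t ≤ Y ω - μ} ≤ Real.exp ((μ * (Real.exp x - 1) - x * (μ + t)) / c) := by
  simp only [le_sub_iff_add_le']
  calc P.real {ω | μ + t ≤ Y ω}
      ≤ Real.exp (-(x / c) * (μ + t)) * mgf Y P (x / c) :=
        measure_ge_le_exp_mul_mgf _ (by positivity) (h.integrable_exp_mul _)
    _ ≤ Real.exp (-(x / c) * (μ + t)) * Real.exp (μ / c * (Real.exp (c * (x / c)) - 1)) := by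
        gcongr
        exact h.mgf_le _
    _ = _ := by
        rw [← Real.exp_add, mul_div_cancel₀ x hc.ne']
        congr 1
        ring

lemma measureReal_le_le (h : HasSubPoissonMGF Y μ c P) (hc : 0 < c) (t : ℝ) {x : ℝ} (hx : x ≤ 0) :
    P.real {ω | Y ω - μ ≤ t} ≤ Real.exp ((μ * (Real.exp x - 1) - x * (μ + t)) / c) := by
  simp only [sub_le_iff_le_add']
  calc P.real {ω | Y ω ≤ μ + t}
      ≤ Real.exp (-(x / c) * (μ + t)) * mgf Y P (x / c) :=
        measure_le_le_exp_mul_mgf _ (div_nonpos_of_nonpos_of_nonneg hx hc.le)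
          (h.integrable_exp_mul _)
    _ ≤ Real.exp (-(x / c) * (μ + t)) * Real.exp (μ / c * (Real.exp (c * (x / c)) - 1)) := by
        gcongr
        exact h.mgf_le _
    _ = _ := by
        rw [← Real.exp_add, mul_div_cancel₀ x hc.ne']
        congr 1
        ring

end Chernoff

lemma exp_chernoff_log (hμ : 0 < μ) {t : ℝ} (ht : 0 < μ + t) :
    Real.exp ((μ * (Real.exp (Real.log ((μ + t) / μ)) - 1) -
        Real.log ((μ + t) / μ) * (μ + t)) / c) =
      (μ / (μ + t)) ^ ((t + μ) / c) * Real.exp (t / c) := by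
  rw [Real.exp_log (by positivity), Real.rpow_def_of_pos (by positivity), ← Real.exp_add,
    ← inv_div (μ + t) μ, Real.log_inv]
  congr 1
  field_simp
  ring

variable [IsFiniteMeasure P]

lemma poisson_upper (h : HasSubPoissonMGF Y μ c P) (hμ : 0 < μ) (hc : 0 < c) {t : ℝ} (ht : 0 ≤ t) :
    P.real {ω | t ≤ Y ω - μ} ≤ (μ / (μ + t)) ^ ((t + μ) / c) * Real.exp (t / c) := by
  rw [← exp_chernoff_log hμ (by linarith)]
  exact h.measureReal_ge_le hc t (Real.log_nonneg (by rw [one_le_div hμ]; linarith))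

lemma poisson_lower (h : HasSubPoissonMGF Y μ c P) (hμ : 0 < μ) (hc : 0 < c) {t : ℝ}
    (hμt : -μ ≤ t) (ht : t ≤ 0) :
    P.real {ω | Y ω - μ ≤ t} ≤ (μ / (μ + t)) ^ ((t + μ) / c) * Real.exp (t / c) := by
  rcases hμt.eq_or_lt with rfl | hμt
  · -- the optimal Chernoff parameter is `-∞` here, so pass to the limit
    have hlim : Filter.Tendsto
        (fun x : ℝ => Real.exp ((μ * (Real.exp x - 1) - x * (μ + -μ)) / c)) Filter.atBot
        (nhds (Real.exp (-μ / c))) := by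
      simpa using (((Real.tendsto_exp_atBot.sub_const 1).const_mul μ).div_const c).rexp
    simpa using ge_of_tendsto hlim
      ((Filter.eventually_le_atBot 0).mono fun x hx => h.measureReal_le_le hc (-μ) hx)
  · have hpos : 0 < μ + t := by linarith
    rw [← exp_chernoff_log hμ hpos]
    exact h.measureReal_le_le hc t
      (Real.log_nonpos (by positivity) (by rw [div_le_one hμ]; linarith))

lemma bernstein_upper (h : HasSubPoissonMGF Y μ c P) (hμ : 0 < μ) (hc : 0 < c) {t : ℝ}
    (ht : 0 < t) :
    P.real {ω | t ≤ Y ω - μ} ≤ Real.exp (-(t ^ 2 / (2 * c * μ + 2 * c * t / 3))) := by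
  set x := t / (μ + t / 3) with hx
  have hx0 : 0 ≤ x := by positivity
  have hexp : μ * Real.exp x ≤ (μ + t / 3) * (1 + 2 * x / 3 + x ^ 2 / 6) :=
    calc μ * Real.exp x = (μ + t / 3) * (Real.exp x * (1 - x / 3)) := by
          rw [hx]
          field_simp
          ring
      _ ≤ _ := by
          gcongr
          exact exp_mul_one_sub_third_le hx0
  calc P.real {ω | t ≤ Y ω - μ}
      ≤ Real.exp ((μ * (Real.exp x - 1) - x * (μ + t)) / c) := h.measureReal_ge_le hc t hx0
    _ ≤ Real.exp (((μ + t / 3) * (1 + 2 * x / 3 + x ^ 2 / 6) - μ - x * (μ + t)) / c) := by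
        gcongr
        linarith
    _ = _ := by
        rw [hx]
        congr 1
        field_simp
        ring

lemma gaussian_lower (h : HasSubPoissonMGF Y μ c P) (hμ : 0 < μ) (hc : 0 < c) {t : ℝ}
    (ht : 0 < t) :
    P.real {ω | Y ω - μ ≤ -t} ≤ Real.exp (-(t ^ 2 / (2 * c * μ))) :=
  calc P.real {ω | Y ω - μ ≤ -t}
      ≤ Real.exp ((μ * (Real.exp (-(t / μ)) - 1) - -(t / μ) * (μ + -t)) / c) :=
        h.measureReal_le_le hc (-t) (neg_nonpos.2 (by positivity))
    _ ≤ Real.exp ((μ * (1 - t / μ + (t / μ) ^ 2 / 2 - 1) - -(t / μ) * (μ + -t)) / c) := by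
        gcongr
        exact exp_neg_le_quadratic (by positivity)
    _ = _ := by
        congr 1
        field_simp
        ring

theorem concentrationBounds (h : HasSubPoissonMGF Y μ c P) (hμ : 0 < μ) (hc : 0 < c) :
    ConcentrationBounds P Y μ c where
  lower _ ht := h.gaussian_lower hμ hc ht
  upper t ht := by
    refine (h.bernstein_upper hμ hc ht).trans ?_
    have : 0 < c * t := by positivity
    gcongr
    linarith
  poisson_upper _ ht := h.poisson_upper hμ hc ht
  poisson_lower _ hμt ht := h.poisson_lower hμ hc hμt ht
  bernstein_upper _ ht := h.bernstein_upper hμ hc ht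

end HasSubPoissonMGF

theorem HasSubPoissonMGF.of_sizeBias [IsProbabilityMeasure P] (hc : c ≠ 0)
    (hint : ∀ θ, Integrable (fun ω => Real.exp (θ * Y ω)) P)
    (hpos : ∀ θ, 0 ≤ θ → ∫ ω, Y ω * Real.exp (θ * Y ω) ∂P ≤ μ * Real.exp (c * θ) * mgf Y P θ)
    (hneg : ∀ θ, θ ≤ 0 → μ * Real.exp (c * θ) * mgf Y P θ ≤ ∫ ω, Y ω * Real.exp (θ * Y ω) ∂P) :
    HasSubPoissonMGF Y μ c P := by
  refine ⟨hint, fun θ => ?_⟩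
  set ψ : ℝ → ℝ := fun θ => μ / c * (Real.exp (c * θ) - 1) with hψ
  have hmgf (θ : ℝ) : HasDerivAt (mgf Y P) (∫ ω, Y ω * Real.exp (θ * Y ω) ∂P) θ :=
    hasDerivAt_mgf (by simp [Set.eq_univ_of_forall (s := integrableExpSet Y P) hint])
  have hψ' (θ : ℝ) : HasDerivAt ψ (μ * Real.exp (c * θ)) θ := by
    refine (((((hasDerivAt_id θ).const_mul c).exp).sub_const 1).const_mul (μ / c)).congr_deriv ?_
    simp only [id_eq]
    field_simp
  have hderiv (θ : ℝ) : HasDerivAt (fun θ => mgf Y P θ * Real.exp (-ψ θ))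
      (((∫ ω, Y ω * Real.exp (θ * Y ω) ∂P) - μ * Real.exp (c * θ) * mgf Y P θ) *
        Real.exp (-ψ θ)) θ :=
    ((hmgf θ).mul (hψ' θ).neg.exp).congr_deriv (by rw [Pi.neg_apply]; ring)
  have hle : mgf Y P θ * Real.exp (-ψ θ) ≤ mgf Y P 0 * Real.exp (-ψ 0) := by
    rcases le_total 0 θ with hθ | hθ
    · exact antitoneOn_of_hasDerivWithinAt_nonpos (convex_Ici 0)
        (fun u _ => (hderiv u).continuousAt.continuousWithinAt)
        (fun u _ => (hderiv u).hasDerivWithinAt)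
        (fun u hu => mul_nonpos_of_nonpos_of_nonneg
          (sub_nonpos.2 (hpos u (interior_subset hu))) (Real.exp_pos _).le)
        Set.self_mem_Ici hθ hθ
    · exact monotoneOn_of_hasDerivWithinAt_nonneg (convex_Iic 0)
        (fun u _ => (hderiv u).continuousAt.continuousWithinAt)
        (fun u _ => (hderiv u).hasDerivWithinAt)
        (fun u hu => mul_nonneg (sub_nonneg.2 (hneg u (Set.mem_Iic.1 (interior_subset hu))))
          (Real.exp_pos _).le)
        hθ Set.self_mem_Iic hθ
  rw [mgf_zero, Real.exp_neg, ← div_eq_mul_inv, div_le_iff₀ (Real.exp_pos _)] at hle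
  simpa [hψ] using hle

end SubPoisson

/-! ### Sums of indicators with bounded size bias -/

section SizeBias

variable {Ω κ : Type*}

/-- The weighted number of the events `A α` that occur. -/
def indicatorSum [Fintype κ] (w : κ → ℝ) (A : κ → Set Ω) (ω : Ω) : ℝ :=
  ∑ α, w α * (A α).indicator 1 ω

lemma indicatorSum_le_add_sum [Fintype κ] {w : κ → ℝ} (hw : ∀ α, 0 ≤ w α) {A : κ → Set Ω}
    (S : Finset κ) {v v' : Ω} (h : ∀ β, β ∉ S → v ∈ A β → v' ∈ A β) :
    indicatorSum w A v ≤ indicatorSum w A v' + ∑ β ∈ S, w β := by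
  classical
  have hS : ∑ β ∈ S, w β = ∑ β, if β ∈ S then w β else 0 := by simp
  rw [hS, indicatorSum, indicatorSum, ← Finset.sum_add_distrib]
  refine Finset.sum_le_sum fun β _ => ?_
  have := hw β
  by_cases hβ : β ∈ S
  · by_cases hv : v ∈ A β <;> by_cases hv' : v' ∈ A β <;> simp [*]
  · by_cases hv : v ∈ A β
    · simp [hβ, hv, h β hβ hv]
    · by_cases hv' : v' ∈ A β <;> simp [*]

lemma indicatorSum_nonneg [Fintype κ] {w : κ → ℝ} (hw : ∀ α, 0 ≤ w α) (A : κ → Set Ω) (ω : Ω) :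
    0 ≤ indicatorSum w A ω :=
  Finset.sum_nonneg fun α _ => mul_nonneg (hw α) (Set.indicator_nonneg (by simp) ω)

lemma indicatorSum_le_sum [Fintype κ] {w : κ → ℝ} (hw : ∀ α, 0 ≤ w α) (A : κ → Set Ω) (ω : Ω) :
    indicatorSum w A ω ≤ ∑ α, w α :=
  Finset.sum_le_sum fun α _ =>
    mul_le_of_le_one_right (hw α) (Set.indicator_apply_le' (by simp) (by simp))

variable [MeasurableSpace Ω] {P : Measure Ω}

/-- The law of `Y` conditioned on the event `A` is stochastically dominated by the law of `Y + c`.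
Multiplying by the probability of `A` avoids conditioning on a null event. -/
def DominatedGiven (P : Measure Ω) (Y : Ω → ℝ) (A : Set Ω) (c : ℝ) : Prop :=
  ∀ F : ℝ → ℝ, Monotone F → ∫ ω in A, F (Y ω) ∂P ≤ P.real A * ∫ ω, F (Y ω + c) ∂P

variable [Fintype κ] {w : κ → ℝ} {A : κ → Set Ω} {c : ℝ}

lemma measurable_indicatorSum (w : κ → ℝ) (hA : ∀ α, MeasurableSet (A α)) :
    Measurable (indicatorSum w A) :=
  Finset.measurable_fun_sum _ fun α _ => (measurable_one.indicator (hA α)).const_mul (w α)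

lemma integral_indicatorSum_mul (w : κ → ℝ) (hA : ∀ α, MeasurableSet (A α)) {g : Ω → ℝ}
    (hg : Integrable g P) :
    ∫ ω, indicatorSum w A ω * g ω ∂P = ∑ α, w α * ∫ ω in A α, g ω ∂P := by
  have hind (α : κ) (ω : Ω) : (A α).indicator 1 ω * g ω = (A α).indicator g ω := by
    by_cases h : ω ∈ A α <;> simp [h]
  simp only [indicatorSum, Finset.sum_mul, mul_assoc, hind]
  rw [integral_finsetSum _ fun α _ => (hg.indicator (hA α)).const_mul (w α)]
  simp only [integral_const_mul, integral_indicator (hA _)]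

lemma integral_indicatorSum [IsFiniteMeasure P] (w : κ → ℝ) (hA : ∀ α, MeasurableSet (A α)) :
    ∫ ω, indicatorSum w A ω ∂P = ∑ α, w α * P.real (A α) := by
  simpa using integral_indicatorSum_mul w hA (integrable_const (1 : ℝ) (μ := P))

lemma integral_indicatorSum_mul_comp_le [IsFiniteMeasure P] (hw : ∀ α, 0 ≤ w α)
    (hA : ∀ α, MeasurableSet (A α)) (hdom : ∀ α, DominatedGiven P (indicatorSum w A) (A α) c)
    {F : ℝ → ℝ} (hF : Monotone F) (hint : Integrable (fun ω => F (indicatorSum w A ω)) P) :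
    ∫ ω, indicatorSum w A ω * F (indicatorSum w A ω) ∂P ≤
      (∫ ω, indicatorSum w A ω ∂P) * ∫ ω, F (indicatorSum w A ω + c) ∂P := by
  rw [integral_indicatorSum_mul w hA hint, integral_indicatorSum w hA, Finset.sum_mul]
  refine Finset.sum_le_sum fun α _ => ?_
  rw [mul_assoc]
  exact mul_le_mul_of_nonneg_left (hdom α F hF) (hw α)

theorem concentrationBounds_indicatorSum [IsProbabilityMeasure P] (hw : ∀ α, 0 ≤ w α)
    (hA : ∀ α, MeasurableSet (A α)) (hμ : 0 < ∫ ω, indicatorSum w A ω ∂P) (hc : 0 < c)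
    (hdom : ∀ α, DominatedGiven P (indicatorSum w A) (A α) c) :
    ConcentrationBounds P (indicatorSum w A) (∫ ω, indicatorSum w A ω ∂P) c := by
  have hint (θ : ℝ) : Integrable (fun ω => Real.exp (θ * indicatorSum w A ω)) P :=
    integrable_exp_mul_of_mem_Icc (measurable_indicatorSum w hA).aemeasurable
      (Filter.Eventually.of_forall fun ω =>
        ⟨indicatorSum_nonneg hw A ω, indicatorSum_le_sum hw A ω⟩)
  have hshift (θ : ℝ) : ∫ ω, Real.exp (θ * (indicatorSum w A ω + c)) ∂P =
      Real.exp (c * θ) * mgf (indicatorSum w A) P θ := by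
    rw [mgf, ← integral_const_mul]
    congr 1 with ω
    rw [← Real.exp_add]
    ring_nf
  refine HasSubPoissonMGF.concentrationBounds (.of_sizeBias hc.ne' hint ?_ ?_) hμ hc
  · intro θ hθ
    have h := integral_indicatorSum_mul_comp_le hw hA hdom (F := fun x => Real.exp (θ * x))
      (fun x y hxy => Real.exp_le_exp.2 (mul_le_mul_of_nonneg_left hxy hθ)) (hint θ)
    rwa [hshift, ← mul_assoc] at h
  · intro θ hθ
    have h := integral_indicatorSum_mul_comp_le hw hA hdom (F := fun x => -Real.exp (θ * x))
      (fun x y hxy => neg_le_neg (Real.exp_le_exp.2 (mul_le_mul_of_nonpos_left hxy hθ)))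
      (hint θ).neg
    simp only [mul_neg, integral_neg] at h
    rwa [neg_le_neg_iff, hshift, ← mul_assoc] at h

end SizeBias

/-! ### Random subsets with a log-concave tilt of their cardinality -/

/-- Log-concavity of a sequence indexed by `ℤ`. For a nonnegative sequence this form excludes
internal zeros. -/
def IsLogConcave (a : ℤ → ℝ) : Prop :=
  ∀ i j k l : ℤ, i ≤ k → k ≤ j → i + j = k + l → a i * a j ≤ a k * a l

lemma isLogConcave_const (c : ℝ) : IsLogConcave fun _ => c := fun _ _ _ _ _ _ _ => le_rfl

lemma IsLogConcave.mul {a b : ℤ → ℝ} (ha : IsLogConcave a) (hb : IsLogConcave b)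
    (ha0 : ∀ i, 0 ≤ a i) (hb0 : ∀ i, 0 ≤ b i) : IsLogConcave fun i => a i * b i := by
  intro i j k l hik hkj hsum
  calc a i * b i * (a j * b j) = a i * a j * (b i * b j) := by ring
    _ ≤ a k * a l * (b k * b l) :=
      mul_le_mul (ha i j k l hik hkj hsum) (hb i j k l hik hkj hsum)
        (mul_nonneg (hb0 _) (hb0 _)) (mul_nonneg (ha0 _) (ha0 _))
    _ = a k * b k * (a l * b l) := by ring

lemma IsLogConcave.comp_sub_left {a : ℤ → ℝ} (ha : IsLogConcave a) (T : ℤ) :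
    IsLogConcave fun i => a (T - i) := by
  intro i j k l hik hkj hsum
  have := ha (T - j) (T - i) (T - k) (T - l) (by lia) (by lia) (by lia)
  linarith

section Levels

variable {ι : Type*} [DecidableEq ι] {s : Finset ι} {x y : ι → ℝ} {r i j : ℤ}
  {φ ψ : Finset ι → ℝ}

/-- The weight of the subset `R` of `s` when each `i ∈ s` independently contributes a factor `x i`
if it lies in `R` and a factor `y i` otherwise. -/
def subsetWeight (s : Finset ι) (x y : ι → ℝ) (R : Finset ι) : ℝ :=
  (∏ i ∈ R, x i) * ∏ i ∈ s \ R, y i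

/-- The weighted sum of `φ` over the subsets of `s` of cardinality `r`. -/
def levelSum (s : Finset ι) (x y : ι → ℝ) (r : ℤ) (φ : Finset ι → ℝ) : ℝ :=
  ∑ R ∈ s.powerset with (R.card : ℤ) = r, subsetWeight s x y R * φ R

/-- The total weight of the subsets of `s` of cardinality `r`. -/
def levelWeight (s : Finset ι) (x y : ι → ℝ) (r : ℤ) : ℝ := levelSum s x y r fun _ => 1

/-- The mean of `φ` over a random subset of `s` of cardinality `r`; it is `0` when the level `r`
has no weight. -/
def levelMean (s : Finset ι) (x y : ι → ℝ) (r : ℤ) (φ : Finset ι → ℝ) : ℝ :=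
  levelSum s x y r φ / levelWeight s x y r

lemma subsetWeight_nonneg (hx : ∀ i ∈ s, 0 ≤ x i) (hy : ∀ i ∈ s, 0 ≤ y i) {R : Finset ι}
    (hR : R ⊆ s) : 0 ≤ subsetWeight s x y R :=
  mul_nonneg (Finset.prod_nonneg fun i hi => hx i (hR hi))
    (Finset.prod_nonneg fun i hi => hy i (Finset.sdiff_subset hi))

lemma subsetWeight_insert_of_notMem {a : ι} (ha : a ∉ s) {R : Finset ι} (hR : R ⊆ s) :
    subsetWeight (insert a s) x y R = y a * subsetWeight s x y R := by
  rw [subsetWeight, subsetWeight, Finset.insert_sdiff_of_notMem _ fun h => ha (hR h),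
    Finset.prod_insert (by simp [ha])]
  ring

lemma subsetWeight_insert_insert {a : ι} (ha : a ∉ s) {R : Finset ι} (hR : R ⊆ s) :
    subsetWeight (insert a s) x y (insert a R) = x a * subsetWeight s x y R := by
  rw [subsetWeight, subsetWeight, Finset.prod_insert fun h => ha (hR h),
    Finset.insert_sdiff_insert, Finset.sdiff_insert_of_notMem ha]
  ring

lemma levelSum_empty : levelSum ∅ x y r φ = if r = 0 then φ ∅ else 0 := by
  simp [levelSum, subsetWeight, Finset.sum_filter, eq_comm]

lemma levelSum_insert {a : ι} (ha : a ∉ s) : levelSum (insert a s) x y r φ =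
    y a * levelSum s x y r φ + x a * levelSum s x y (r - 1) fun R => φ (insert a R) := by
  simp only [levelSum, Finset.sum_filter, Finset.sum_powerset_insert ha, Finset.mul_sum]
  congr 1 <;> refine Finset.sum_congr rfl fun R hR => ?_
  · rw [subsetWeight_insert_of_notMem ha (Finset.mem_powerset.1 hR), mul_ite, mul_zero, mul_assoc]
  · rw [subsetWeight_insert_insert ha (Finset.mem_powerset.1 hR),
      Finset.card_insert_of_notMem fun h => ha (Finset.mem_powerset.1 hR h), mul_ite, mul_zero,
      mul_assoc]
    simp only [Nat.cast_add, Nat.cast_one, eq_sub_iff_add_eq]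

lemma levelWeight_insert {a : ι} (ha : a ∉ s) : levelWeight (insert a s) x y r =
    y a * levelWeight s x y r + x a * levelWeight s x y (r - 1) :=
  levelSum_insert ha

lemma levelSum_neg : levelSum s x y r (fun R => -φ R) = -levelSum s x y r φ := by
  simp [levelSum]

lemma levelSum_mono (hx : ∀ i ∈ s, 0 ≤ x i) (hy : ∀ i ∈ s, 0 ≤ y i)
    (h : ∀ R ⊆ s, (R.card : ℤ) = r → φ R ≤ ψ R) : levelSum s x y r φ ≤ levelSum s x y r ψ := by
  refine Finset.sum_le_sum fun R hR => ?_
  rw [Finset.mem_filter, Finset.mem_powerset] at hR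
  exact mul_le_mul_of_nonneg_left (h R hR.1 hR.2) (subsetWeight_nonneg hx hy hR.1)

lemma levelWeight_nonneg (hx : ∀ i ∈ s, 0 ≤ x i) (hy : ∀ i ∈ s, 0 ≤ y i) (r : ℤ) :
    0 ≤ levelWeight s x y r := by
  simpa [levelWeight, levelSum] using
    levelSum_mono (r := r) (φ := fun _ => 0) (ψ := fun _ => 1) hx hy fun _ _ _ => zero_le_one

lemma levelSum_eq_zero (hx : ∀ i ∈ s, 0 ≤ x i) (hy : ∀ i ∈ s, 0 ≤ y i)
    (h : levelWeight s x y r = 0) (φ : Finset ι → ℝ) : levelSum s x y r φ = 0 := by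
  have hzero (R : Finset ι) (hR : R ∈ s.powerset.filter fun R => (R.card : ℤ) = r) :
      subsetWeight s x y R = 0 := by
    simp only [levelWeight, levelSum, mul_one] at h
    exact (Finset.sum_eq_zero_iff_of_nonneg fun R hR => subsetWeight_nonneg hx hy
      (Finset.mem_powerset.1 (Finset.mem_filter.1 hR).1)).1 h R hR
  exact Finset.sum_eq_zero fun R hR => by rw [hzero R hR, zero_mul]

lemma levelWeight_mul_levelMean (hx : ∀ i ∈ s, 0 ≤ x i) (hy : ∀ i ∈ s, 0 ≤ y i) (r : ℤ)
    (φ : Finset ι → ℝ) : levelWeight s x y r * levelMean s x y r φ = levelSum s x y r φ :=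
  mul_div_cancel_of_imp' fun h => levelSum_eq_zero hx hy h φ

lemma sum_powerset_eq_sum_levelSum (a : ℤ → ℝ) :
    ∑ R ∈ s.powerset, a R.card * (subsetWeight s x y R * φ R) =
      ∑ r ∈ Finset.range (s.card + 1), a r * levelSum s x y r φ := by
  rw [← Finset.sum_fiberwise_of_maps_to (g := Finset.card) (t := Finset.range (s.card + 1))
    fun R hR => Finset.mem_range_succ_iff.2 (Finset.card_le_card (Finset.mem_powerset.1 hR))]
  refine Finset.sum_congr rfl fun r _ => ?_
  simp only [levelSum, Finset.mul_sum, Nat.cast_inj]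
  exact Finset.sum_congr rfl fun R hR => by rw [(Finset.mem_filter.1 hR).2]

lemma isLogConcave_levelWeight (hx : ∀ i ∈ s, 0 ≤ x i) (hy : ∀ i ∈ s, 0 ≤ y i) :
    IsLogConcave (levelWeight s x y) := by
  induction s using Finset.induction_on with
  | empty =>
    intro i j k l hik hkj hsum
    simp only [levelWeight, levelSum_empty]
    by_cases h : i = 0 ∧ j = 0
    · rw [if_pos h.1, if_pos h.2, if_pos (by lia), if_pos (by lia)]
    · rw [ite_zero_mul_ite_zero, if_neg h]
      positivity
  | insert a s ha ih =>
    rw [Finset.forall_mem_insert] at hx hy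
    have hlc := ih hx.2 hy.2
    intro i j k l hik hkj hsum
    simp only [levelWeight_insert ha]
    rcases hkj.eq_or_lt with rfl | hkj
    · obtain rfl : i = l := by lia
      exact (mul_comm _ _).le
    have hyy := mul_le_mul_of_nonneg_left (hlc i j k l hik hkj.le hsum) (mul_nonneg hy.1 hy.1)
    have hxx := mul_le_mul_of_nonneg_left
      (hlc (i - 1) (j - 1) (k - 1) (l - 1) (by lia) (by lia) (by lia)) (mul_nonneg hx.1 hx.1)
    have hyx := mul_le_mul_of_nonneg_left
      (hlc i (j - 1) k (l - 1) (by lia) (by lia) (by lia)) (mul_nonneg hx.1 hy.1)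
    have hxy := mul_le_mul_of_nonneg_left
      (hlc (i - 1) j (k - 1) l (by lia) (by lia) (by lia)) (mul_nonneg hx.1 hy.1)
    linarith

-- With `v = pA * pD` and `u = pB * pC`, multiplying the claim by `v` reduces it to
-- `0 ≤ (v - u) * (pA * D - A * pD)`.
lemma mul_add_mul_le_of_cross {A B C D pA pB pC pD : ℝ} (hpA : 0 ≤ pA) (hpB : 0 ≤ pB)
    (hpC : 0 ≤ pC) (hpD : 0 ≤ pD) (hp : pB * pC ≤ pA * pD) (hB : pB = 0 → B = 0)
    (hC : pC = 0 → C = 0) (hAC : A * pC ≤ pA * C) (hBD : B * pD ≤ pB * D)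
    (hAD : A * pD ≤ pA * D) : A * pD + B * pC ≤ pA * D + pB * C := by
  rcases (mul_nonneg hpB hpC).eq_or_lt with hzero | hpos
  · rcases mul_eq_zero.1 hzero.symm with h | h
    · simpa [hB h, h] using hAD
    · simpa [hC h, h] using hAD
  · refine le_of_mul_le_mul_right ?_ (hpos.trans_le hp)
    have h₁ := mul_le_mul_of_nonneg_left hAC (mul_nonneg hpB hpD)
    have h₂ := mul_le_mul_of_nonneg_left hBD (mul_nonneg hpA hpC)
    have h₃ := mul_nonneg (sub_nonneg.2 hp) (sub_nonneg.2 hAD)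
    linarith

theorem levelSum_mul_levelWeight_le (hx : ∀ i ∈ s, 0 ≤ x i) (hy : ∀ i ∈ s, 0 ≤ y i) (hij : i ≤ j)
    (h : ∀ R R', R ⊆ R' → R' ⊆ s → (R.card : ℤ) = i → (R'.card : ℤ) = j → φ R ≤ ψ R') :
    levelSum s x y i φ * levelWeight s x y j ≤ levelWeight s x y i * levelSum s x y j ψ := by
  induction s using Finset.induction_on generalizing i j φ ψ with
  | empty =>
    simp only [levelWeight, levelSum_empty]
    by_cases h0 : i = 0 ∧ j = 0
    · simpa [h0.1, h0.2] using h ∅ ∅ subset_rfl subset_rfl (by simp [h0.1]) (by simp [h0.2])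
    · rw [ite_zero_mul_ite_zero, ite_zero_mul_ite_zero, if_neg h0, if_neg h0]
  | insert a s ha ih =>
    rcases hij.eq_or_lt with rfl | hlt
    · rw [mul_comm]
      exact mul_le_mul_of_nonneg_left
        (levelSum_mono hx hy fun R hR hi => h R R subset_rfl hR hi hi) (levelWeight_nonneg hx hy i)
    rw [Finset.forall_mem_insert] at hx hy
    have hw := levelWeight_nonneg hx.2 hy.2
    have hcard {R : Finset ι} (hR : R ⊆ s) : ((insert a R).card : ℤ) = R.card + 1 := by
      rw [Finset.card_insert_of_notMem fun h => ha (hR h), Nat.cast_succ]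
    have hAC := ih (i := i) (j := j) (φ := φ) (ψ := ψ) hx.2 hy.2 hij fun R R' hRR' hR' =>
      h R R' hRR' (hR'.trans (Finset.subset_insert a s))
    have hBD := ih (i := i - 1) (j := j - 1) (φ := fun R => φ (insert a R))
      (ψ := fun R => ψ (insert a R)) hx.2 hy.2 (by lia) fun R R' hRR' hR' hi hj =>
        h _ _ (Finset.insert_subset_insert a hRR') (Finset.insert_subset_insert a hR')
          (by rw [hcard (hRR'.trans hR')]; lia) (by rw [hcard hR']; lia)
    have hAD := ih (i := i) (j := j - 1) (φ := φ) (ψ := fun R => ψ (insert a R)) hx.2 hy.2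
      (by lia) fun R R' hRR' hR' hi hj =>
        h _ _ (hRR'.trans (Finset.subset_insert a R')) (Finset.insert_subset_insert a hR') hi
          (by rw [hcard hR']; lia)
    have hcross := mul_add_mul_le_of_cross (hw i) (hw (i - 1)) (hw j) (hw (j - 1))
      (isLogConcave_levelWeight hx.2 hy.2 (i - 1) j i (j - 1) (by lia) (by lia) (by lia))
      (fun h0 => levelSum_eq_zero hx.2 hy.2 h0 _) (fun h0 => levelSum_eq_zero hx.2 hy.2 h0 _)
      hAC hBD hAD
    rw [levelSum_insert ha, levelSum_insert ha, levelWeight_insert ha, levelWeight_insert ha]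
    have hyy := mul_le_mul_of_nonneg_left hAC (mul_nonneg hy.1 hy.1)
    have hxx := mul_le_mul_of_nonneg_left hBD (mul_nonneg hx.1 hx.1)
    have hxy := mul_le_mul_of_nonneg_left hcross (mul_nonneg hx.1 hy.1)
    linarith

lemma levelMean_mono (hx : ∀ i ∈ s, 0 ≤ x i) (hy : ∀ i ∈ s, 0 ≤ y i)
    (h : ∀ R ⊆ s, (R.card : ℤ) = r → φ R ≤ ψ R) : levelMean s x y r φ ≤ levelMean s x y r ψ :=
  div_le_div_of_nonneg_right (levelSum_mono hx hy h) (levelWeight_nonneg hx hy r)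

lemma levelMean_le_levelMean (hx : ∀ i ∈ s, 0 ≤ x i) (hy : ∀ i ∈ s, 0 ≤ y i) (hij : i ≤ j)
    (hi : 0 < levelWeight s x y i) (hj : 0 < levelWeight s x y j)
    (h : ∀ R R', R ⊆ R' → R' ⊆ s → (R.card : ℤ) = i → (R'.card : ℤ) = j → φ R ≤ ψ R') :
    levelMean s x y i φ ≤ levelMean s x y j ψ := by
  rw [levelMean, levelMean, div_le_div_iff₀ hi hj, mul_comm (levelSum s x y j ψ)]
  exact levelSum_mul_levelWeight_le hx hy hij h

lemma levelMean_le_levelMean' (hx : ∀ i ∈ s, 0 ≤ x i) (hy : ∀ i ∈ s, 0 ≤ y i) (hij : i ≤ j)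
    (hi : 0 < levelWeight s x y i) (hj : 0 < levelWeight s x y j)
    (h : ∀ R R', R ⊆ R' → R' ⊆ s → (R.card : ℤ) = i → (R'.card : ℤ) = j → φ R' ≤ ψ R) :
    levelMean s x y j φ ≤ levelMean s x y i ψ := by
  have := levelMean_le_levelMean (φ := fun R => -ψ R) (ψ := fun R => -φ R) hx hy hij hi hj
    fun R R' hRR' hR' hi hj => neg_le_neg (h R R' hRR' hR' hi hj)
  simpa only [levelMean, levelSum_neg, neg_div, neg_le_neg_iff] using this

end Levels

/-! ### Comparing conditional means -/

section ConditionalMeans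

lemma sum_filter_mul_sum_le {ι : Type*} {I : Finset ι} {D : ι → Prop} [DecidablePred D]
    {p f g : ι → ℝ} (hp : ∀ i, 0 ≤ p i) (hfg : ∀ i, f i ≤ g i)
    (h : ∀ i j, D i → ¬ D j → 0 < p i → 0 < p j → f i ≤ g j) :
    (∑ i ∈ I with D i, p i * f i) * ∑ i ∈ I, p i ≤
      (∑ i ∈ I with D i, p i) * ∑ i ∈ I, p i * g i := by
  rw [← Finset.sum_filter_add_sum_filter_not I D p,
    ← Finset.sum_filter_add_sum_filter_not I D fun i => p i * g i, mul_add, mul_add]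
  refine add_le_add ?_ ?_
  · rw [mul_comm]
    exact mul_le_mul_of_nonneg_left
      (Finset.sum_le_sum fun i _ => mul_le_mul_of_nonneg_left (hfg i) (hp i))
      (Finset.sum_nonneg fun i _ => hp i)
  · rw [Finset.sum_mul_sum, Finset.sum_mul_sum]
    refine Finset.sum_le_sum fun i hi => Finset.sum_le_sum fun j hj => ?_
    rcases (hp i).eq_or_lt with hi0 | hi0
    · simp [← hi0]
    rcases (hp j).eq_or_lt with hj0 | hj0
    · simp [← hj0]
    have hij := h i j (Finset.mem_filter.1 hi).2 (Finset.mem_filter.1 hj).2 hi0 hj0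
    calc p i * f i * p j = p i * p j * f i := by ring
      _ ≤ p i * p j * g j := mul_le_mul_of_nonneg_left hij (by positivity)
      _ = p i * (p j * g j) := by ring

lemma mul_sum_Ico_le {p : ℕ → ℝ} (hp : ∀ i, 0 ≤ p i)
    (hlc : ∀ i j, p 0 * p (i + j) ≤ p i * p j) (j N : ℕ) :
    p 0 * ∑ i ∈ Finset.Ico j N, p (i + 1) ≤ p (j + 1) * ∑ i ∈ Finset.range (N + 1), p i := by
  calc p 0 * ∑ i ∈ Finset.Ico j N, p (i + 1)
      = ∑ k ∈ Finset.range (N - j), p 0 * p (j + 1 + k) := by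
        simp only [Finset.sum_Ico_eq_sum_range, Finset.mul_sum, add_right_comm]
    _ ≤ ∑ k ∈ Finset.range (N - j), p (j + 1) * p k := Finset.sum_le_sum fun k _ => hlc _ _
    _ ≤ p (j + 1) * ∑ i ∈ Finset.range (N + 1), p i := by
        rw [← Finset.mul_sum]
        exact mul_le_mul_of_nonneg_left (Finset.sum_le_sum_of_subset_of_nonneg
          (Finset.range_mono (by lia)) fun i _ _ => hp i) (hp _)

-- The law `p` conditioned on `{1, …, N}` is coupled with `p` on `{0, …, N}` by moving the mass
-- `p 0 * T j` from `j + 1` to `j`, where `T j` is the mass of `{j + 1, …, N}`.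
lemma sum_succ_mul_sum_le {p f g : ℕ → ℝ} (hp : ∀ i, 0 ≤ p i)
    (hlc : ∀ i j, p 0 * p (i + j) ≤ p i * p j) (hfg : ∀ i, f i ≤ g i)
    (hshift : ∀ i, 0 < p i → 0 < p (i + 1) → f (i + 1) ≤ g i) (N : ℕ) :
    (∑ j ∈ Finset.range N, p (j + 1) * f (j + 1)) * ∑ i ∈ Finset.range (N + 1), p i ≤
      (∑ j ∈ Finset.range N, p (j + 1)) * ∑ i ∈ Finset.range (N + 1), p i * g i := by
  set U := ∑ i ∈ Finset.range (N + 1), p i with hU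
  set T : ℕ → ℝ := fun j => ∑ i ∈ Finset.Ico j N, p (i + 1) with hT
  have hT0 : ∑ j ∈ Finset.range N, p (j + 1) = T 0 := by rw [Finset.range_eq_Ico]
  have hUT : U = T 0 + p 0 := by rw [hU, Finset.sum_range_succ', hT0]
  have hTsucc (j : ℕ) (hj : j < N) : T j = p (j + 1) + T (j + 1) :=
    Finset.sum_eq_sum_Ico_succ_bot hj _
  have hterm (j : ℕ) : U * (p (j + 1) * f (j + 1)) ≤
      p 0 * T j * g j + (p (j + 1) * U - p 0 * T j) * g (j + 1) := by
    have hmass : p 0 * T j ≤ p (j + 1) * U := mul_sum_Ico_le hp hlc j N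
    have hnn : 0 ≤ p 0 * T j := mul_nonneg (hp 0) (Finset.sum_nonneg fun i _ => hp _)
    have hstay := mul_le_mul_of_nonneg_left (hfg (j + 1)) (sub_nonneg.2 hmass)
    have hmove : p 0 * T j * f (j + 1) ≤ p 0 * T j * g j := by
      rcases hnn.eq_or_lt with h0 | hpos
      · simp [← h0]
      have hp0 : 0 < p 0 := pos_of_mul_pos_left hpos (Finset.sum_nonneg fun i _ => hp _)
      have hpj1 : 0 < p (j + 1) := pos_of_mul_pos_left (hpos.trans_le hmass)
        (Finset.sum_nonneg fun i _ => hp i)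
      have hpj : 0 < p j := pos_of_mul_pos_left ((mul_pos hp0 hpj1).trans_le (hlc j 1)) (hp 1)
      exact mul_le_mul_of_nonneg_left (hshift j hpj hpj1) hnn
    linarith
  have htele : ∑ j ∈ Finset.range N, (T j * g j - T (j + 1) * g (j + 1)) = T 0 * g 0 := by
    rw [Finset.sum_range_sub' fun j => T j * g j]
    simp [hT]
  calc (∑ j ∈ Finset.range N, p (j + 1) * f (j + 1)) * U
      = ∑ j ∈ Finset.range N, U * (p (j + 1) * f (j + 1)) := by rw [mul_comm, Finset.mul_sum]
    _ ≤ ∑ j ∈ Finset.range N, (p 0 * (T j * g j - T (j + 1) * g (j + 1)) +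
          T 0 * (p (j + 1) * g (j + 1))) := by
        refine Finset.sum_le_sum fun j hj => (hterm j).trans_eq ?_
        rw [hUT, hTsucc j (Finset.mem_range.1 hj)]
        ring
    _ = (∑ j ∈ Finset.range N, p (j + 1)) * ∑ i ∈ Finset.range (N + 1), p i * g i := by
        rw [Finset.sum_add_distrib, ← Finset.mul_sum, ← Finset.mul_sum, htele, hT0,
          Finset.sum_range_succ' fun i => p i * g i]
        ring

lemma sum_range_eq_add_sum_sub_add_sum_add (f : ℤ → ℝ) (e N : ℕ) :
    ∑ r ∈ Finset.range (e + 1 + N), f r = f e +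
      (∑ j ∈ Finset.range e, f (e - (j + 1 : ℕ)) + ∑ j ∈ Finset.range N, f (e + (j + 1 : ℕ))) := by
  rw [Finset.sum_range_add, Finset.sum_range_succ, ← Finset.sum_range_reflect]
  have hbelow (j : ℕ) (hj : j ∈ Finset.range e) : f (e - 1 - j : ℕ) = f (e - (j + 1 : ℕ)) := by
    rw [Nat.sub_sub, add_comm 1 j, Nat.cast_sub (Finset.mem_range.1 hj)]
  have habove (j : ℕ) : f (e + 1 + j : ℕ) = f (e + (j + 1 : ℕ)) := by
    rw [add_assoc, add_comm 1 j, Nat.cast_add]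
  rw [Finset.sum_congr rfl hbelow]
  simp only [habove]
  ring

lemma sum_range_ne_eq (f : ℤ → ℝ) (e N : ℕ) :
    ∑ r ∈ Finset.range (e + 1 + N) with ((r : ℕ) : ℤ) ≠ e, f r =
      ∑ j ∈ Finset.range e, f (e - (j + 1 : ℕ)) + ∑ j ∈ Finset.range N, f (e + (j + 1 : ℕ)) := by
  have hne (j : ℕ) : (j : ℤ) + 1 ≠ 0 := by lia
  have h := sum_range_eq_add_sum_sub_add_sum_add (fun r => if r ≠ e then f r else 0) e N
  simpa [Finset.sum_filter, hne] using h

variable {p f g : ℤ → ℝ}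

lemma sum_above_mul_sum_le (hp : ∀ i, 0 ≤ p i) (hlc : IsLogConcave p) (hfg : ∀ i, f i ≤ g i)
    (hdown : ∀ i, 0 < p i → 0 < p (i + 1) → f (i + 1) ≤ g i) (e : ℤ) (N : ℕ) :
    (∑ j ∈ Finset.range N, p (e + (j + 1 : ℕ)) * f (e + (j + 1 : ℕ))) *
        (∑ j ∈ Finset.range N, p (e + (j + 1 : ℕ)) + p e) ≤
      (∑ j ∈ Finset.range N, p (e + (j + 1 : ℕ))) *
        (∑ j ∈ Finset.range N, p (e + (j + 1 : ℕ)) * g (e + (j + 1 : ℕ)) + p e * g e) := by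
  have h := sum_succ_mul_sum_le (p := fun j => p (e + j)) (f := fun j => f (e + j))
    (g := fun j => g (e + j)) (fun i => hp _) (fun i j => hlc _ _ _ _ (by lia) (by lia) (by lia))
    (fun i => hfg _)
    (fun i hi hi1 => by
      rw [Nat.cast_succ, ← add_assoc] at hi1 ⊢
      exact hdown _ hi hi1) N
  simpa only [Finset.sum_range_succ', Nat.cast_zero, add_zero] using h

lemma sum_below_mul_sum_le (hp : ∀ i, 0 ≤ p i) (hlc : IsLogConcave p) (hfg : ∀ i, f i ≤ g i)
    (hup : ∀ i, 0 < p i → 0 < p (i + 1) → f i ≤ g (i + 1)) (e : ℤ) (N : ℕ) :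
    (∑ j ∈ Finset.range N, p (e - (j + 1 : ℕ)) * f (e - (j + 1 : ℕ))) *
        (∑ j ∈ Finset.range N, p (e - (j + 1 : ℕ)) + p e) ≤
      (∑ j ∈ Finset.range N, p (e - (j + 1 : ℕ))) *
        (∑ j ∈ Finset.range N, p (e - (j + 1 : ℕ)) * g (e - (j + 1 : ℕ)) + p e * g e) := by
  have h := sum_succ_mul_sum_le (p := fun j => p (e - j)) (f := fun j => f (e - j))
    (g := fun j => g (e - j)) (fun i => hp _)
    (fun i j => (mul_comm _ _).trans_le (hlc _ _ _ _ (by lia) (by lia) (by lia)))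
    (fun i => hfg _)
    (fun i hi hi1 => by
      have hi' : (e - i : ℤ) = e - (i + 1 : ℕ) + 1 := by lia
      rw [hi'] at hi ⊢
      exact hup _ hi1 hi) N
  simpa only [Finset.sum_range_succ', Nat.cast_zero, sub_zero] using h

lemma sum_ne_mul_sum_le (hp : ∀ i, 0 ≤ p i) (hlc : IsLogConcave p) (hfg : ∀ i, f i ≤ g i)
    (hdown : ∀ i, 0 < p i → 0 < p (i + 1) → f (i + 1) ≤ g i)
    (hup : ∀ i, 0 < p i → 0 < p (i + 1) → f i ≤ g (i + 1)) (d : ℤ) (n : ℕ) :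
    (∑ r ∈ Finset.range n with ((r : ℕ) : ℤ) ≠ d, p r * f r) * ∑ r ∈ Finset.range n, p r ≤
      (∑ r ∈ Finset.range n with ((r : ℕ) : ℤ) ≠ d, p r) * ∑ r ∈ Finset.range n, p r * g r := by
  have hmono (q : ℕ → ℤ) (K : ℕ) : ∑ j ∈ Finset.range K, p (q j) * f (q j) ≤
      ∑ j ∈ Finset.range K, p (q j) * g (q j) :=
    Finset.sum_le_sum fun j _ => mul_le_mul_of_nonneg_left (hfg _) (hp _)
  have hmass (q : ℕ → ℤ) (K : ℕ) : 0 ≤ ∑ j ∈ Finset.range K, p (q j) :=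
    Finset.sum_nonneg fun j _ => hp _
  by_cases hd : 0 ≤ d ∧ d < n
  · lift d to ℕ using hd.1 with e
    obtain ⟨N, rfl⟩ : ∃ N, n = e + 1 + N := Nat.exists_eq_add_of_le (by lia)
    have habove := sum_above_mul_sum_le hp hlc hfg hdown e N
    have hbelow := sum_below_mul_sum_le hp hlc hfg hup e e
    have hcross := mul_le_mul_of_nonneg_right (hmono (fun j => e + (j + 1 : ℕ)) N)
      (hmass (fun j => e - (j + 1 : ℕ)) e)
    have hcross' := mul_le_mul_of_nonneg_right (hmono (fun j => e - (j + 1 : ℕ)) e)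
      (hmass (fun j => e + (j + 1 : ℕ)) N)
    rw [sum_range_ne_eq fun r => p r * f r, sum_range_ne_eq p,
      sum_range_eq_add_sum_sub_add_sum_add p,
      sum_range_eq_add_sum_sub_add_sum_add fun r => p r * g r]
    linarith
  · have hall : ∀ r ∈ Finset.range n, (r : ℤ) ≠ d := fun r hr => by
      have := Finset.mem_range.1 hr
      lia
    rw [Finset.filter_true_of_mem hall, mul_comm]
    exact mul_le_mul_of_nonneg_left (hmono _ n) (hmass _ n)

end ConditionalMeans

/-! ### Tilted Bernoulli sets -/

/-- An unnormalized law of a random subset `R` of `support`: independent inclusions with relative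
odds `x i : y i`, tilted by a log-concave function `a` of the cardinality of `R`. -/
structure TiltedBernoulli (ι : Type*) where
  support : Finset ι
  x : ι → ℝ
  y : ι → ℝ
  a : ℤ → ℝ
  x_nonneg : ∀ i ∈ support, 0 ≤ x i
  y_nonneg : ∀ i ∈ support, 0 ≤ y i
  a_nonneg : ∀ r, 0 ≤ a r
  isLogConcave_a : IsLogConcave a

namespace TiltedBernoulli

variable {ι : Type*} [DecidableEq ι] (B : TiltedBernoulli ι) (φ ψ : Finset ι → ℝ)

/-- The integral of `φ` against the unnormalized law `B`. -/
def sum (φ : Finset ι → ℝ) : ℝ :=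
  ∑ R ∈ B.support.powerset, B.a R.card * (subsetWeight B.support B.x B.y R * φ R)

/-- The mass which `B` gives to the sets of cardinality `r`. -/
def mass (r : ℤ) : ℝ := B.a r * levelWeight B.support B.x B.y r

/-- The mean of `φ` under `B` conditioned on the cardinality `r`. -/
def mean (φ : Finset ι → ℝ) (r : ℤ) : ℝ := levelMean B.support B.x B.y r φ

lemma mass_nonneg (r : ℤ) : 0 ≤ B.mass r :=
  mul_nonneg (B.a_nonneg r) (levelWeight_nonneg B.x_nonneg B.y_nonneg r)

lemma isLogConcave_mass : IsLogConcave B.mass :=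
  B.isLogConcave_a.mul (isLogConcave_levelWeight B.x_nonneg B.y_nonneg) B.a_nonneg
    (levelWeight_nonneg B.x_nonneg B.y_nonneg)

variable {B} in
lemma levelWeight_pos_of_mass_pos {r : ℤ} (h : 0 < B.mass r) :
    0 < levelWeight B.support B.x B.y r :=
  pos_of_mul_pos_right h (B.a_nonneg r)

lemma sum_ite (D : ℤ → Prop) [DecidablePred D] : B.sum (fun R => if D R.card then φ R else 0) =
    ∑ r ∈ Finset.range (B.support.card + 1) with D ((r : ℕ) : ℤ), B.mass r * B.mean φ r := by
  have h := sum_powerset_eq_sum_levelSum (s := B.support) (x := B.x) (y := B.y) (φ := φ)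
    fun r => if D r then B.a r else 0
  simpa only [sum, mass, mean, mul_assoc, levelWeight_mul_levelMean B.x_nonneg B.y_nonneg,
    Finset.sum_filter, ite_mul, mul_ite, mul_zero, zero_mul] using h

lemma sum_eq : B.sum φ =
    ∑ r ∈ Finset.range (B.support.card + 1), B.mass r * B.mean φ r := by
  simpa using B.sum_ite φ fun _ => True

lemma mass_mul_mean_one (r : ℤ) : B.mass r * B.mean (fun _ => 1) r = B.mass r := by
  rw [mass, mean, mul_assoc, levelWeight_mul_levelMean B.x_nonneg B.y_nonneg]
  rfl

variable {φ ψ}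

lemma mean_mono (h : ∀ R ⊆ B.support, φ R ≤ ψ R) (r : ℤ) : B.mean φ r ≤ B.mean ψ r :=
  levelMean_mono B.x_nonneg B.y_nonneg fun R hR _ => h R hR

theorem sum_lowerSet_mul_sum_le {D : ℤ → Prop} [DecidablePred D]
    (hD : IsLowerSet {r | D r}) (h : ∀ R R', R ⊆ R' → R' ⊆ B.support → φ R ≤ ψ R') :
    B.sum (fun R => if D R.card then φ R else 0) * B.sum (fun _ => 1) ≤
      B.sum (fun R => if D R.card then 1 else 0) * B.sum ψ := by
  simp only [B.sum_ite _ D, sum_eq, mass_mul_mean_one]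
  refine sum_filter_mul_sum_le (p := fun r : ℕ => B.mass r) (f := fun r => B.mean φ r)
    (g := fun r => B.mean ψ r) (fun r => B.mass_nonneg r)
    (fun r => B.mean_mono (fun R hR => h R R subset_rfl hR) r) fun i j hi hj hi0 hj0 => ?_
  have hij : (i : ℤ) ≤ j := le_of_not_ge fun hji => hj (hD hji hi)
  exact levelMean_le_levelMean B.x_nonneg B.y_nonneg hij (levelWeight_pos_of_mass_pos hi0)
    (levelWeight_pos_of_mass_pos hj0) fun R R' hRR' hR' _ _ => h R R' hRR' hR'

theorem sum_ne_mul_sum_le (d : ℤ) (hrefl : ∀ R ⊆ B.support, φ R ≤ ψ R)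
    (hinsert : ∀ b R, b ∉ R → insert b R ⊆ B.support →
      φ R ≤ ψ (insert b R) ∧ φ (insert b R) ≤ ψ R) :
    B.sum (fun R => if (R.card : ℤ) ≠ d then φ R else 0) * B.sum (fun _ => 1) ≤
      B.sum (fun R => if (R.card : ℤ) ≠ d then 1 else 0) * B.sum ψ := by
  have hcover {i : ℤ} {R R' : Finset ι} (hRR' : R ⊆ R') (hR : (R.card : ℤ) = i)
      (hR' : (R'.card : ℤ) = i + 1) : ∃ b ∉ R, insert b R = R' :=
    Finset.exists_eq_insert_iff.2 ⟨hRR', by lia⟩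
  simp only [B.sum_ite _ (· ≠ d), sum_eq, mass_mul_mean_one]
  refine Occupancy.sum_ne_mul_sum_le B.mass_nonneg B.isLogConcave_mass (B.mean_mono hrefl)
    (fun i hi hi1 => ?_) (fun i hi hi1 => ?_) d _
  · refine levelMean_le_levelMean' B.x_nonneg B.y_nonneg (lt_add_one i).le
      (levelWeight_pos_of_mass_pos hi) (levelWeight_pos_of_mass_pos hi1)
      fun R R' hRR' hR' hi hj => ?_
    obtain ⟨b, hb, rfl⟩ := hcover hRR' hi hj
    exact (hinsert b R hb hR').2
  · refine levelMean_le_levelMean B.x_nonneg B.y_nonneg (lt_add_one i).le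
      (levelWeight_pos_of_mass_pos hi) (levelWeight_pos_of_mass_pos hi1)
      fun R R' hRR' hR' hi hj => ?_
    obtain ⟨b, hb, rfl⟩ := hcover hRR' hi hj
    exact (hinsert b R hb hR').1

end TiltedBernoulli

/-! ### Color splits -/

/-- A description of the law of a random count vector as seen from a color `α`: a random set `R`
collects the objects whose color is not `α`, and their colors are revealed independently of `R`,
object `i` receiving the color `loc z i` with probability `ρ z`. The remaining part of the total
`T` has color `α`. -/
structure ColorSplit (ι ζ κ : Type*) [Fintype ζ] extends TiltedBernoulli ι where
  T : ℤ
  ρ : ζ → ℝ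
  loc : ζ → ι → κ
  ρ_nonneg : ∀ z, 0 ≤ ρ z
  sum_ρ : ∑ z, ρ z = 1

lemma measurableSet_count {Ω κ : Type*} [MeasurableSpace Ω] {M : κ → Ω → ℕ}
    (hM : ∀ β, Measurable (M β)) (D : ℤ → Prop) (α : κ) : MeasurableSet {ω | D (M α ω)} :=
  hM α (.of_discrete (s := {k : ℕ | D k}))

namespace ColorSplit

variable {ι ζ κ : Type*} [Fintype ζ] [DecidableEq κ] (C : ColorSplit ι ζ κ)
  (α : κ)

/-- The count vector when `R` is the set of objects whose color is not `α`. -/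
def count (z : ζ) (R : Finset ι) (β : κ) : ℤ :=
  if β = α then C.T - R.card else {i ∈ R | C.loc z i = β}.card

/-- The mean of `Φ` over the colors of the objects in `R`. -/
def avg (Φ : (κ → ℤ) → ℝ) (R : Finset ι) : ℝ := ∑ z, C.ρ z * Φ (C.count α z R)

/-- The count vector `M` has the law described by `C` as seen from the color `α`. -/
def Represents [DecidableEq ι] {Ω : Type*} [MeasurableSpace Ω] (P : Measure Ω)
    (M : κ → Ω → ℕ) : Prop :=
  ∀ Φ : (κ → ℤ) → ℝ, ∫ ω, Φ (fun β => M β ω) ∂P = C.sum (C.avg α Φ)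

variable {C α} {Φ Ψ : (κ → ℤ) → ℝ} {R R' : Finset ι}

lemma avg_le_avg (h : ∀ z, Φ (C.count α z R) ≤ Ψ (C.count α z R')) :
    C.avg α Φ R ≤ C.avg α Ψ R' :=
  Finset.sum_le_sum fun z _ => mul_le_mul_of_nonneg_left (h z) (C.ρ_nonneg z)

lemma avg_const (c : ℝ) : C.avg α (fun _ => c) = fun _ => c := by
  funext R
  rw [avg, ← Finset.sum_mul, C.sum_ρ, one_mul]

lemma avg_ite (D : ℤ → Prop) [DecidablePred D] : C.avg α (fun v => if D (v α) then Φ v else 0) R =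
    if D (C.T - R.card) then C.avg α Φ R else 0 := by
  by_cases h : D (C.T - R.card) <;> simp [avg, count, h]

lemma count_mono {β : κ} (hβ : β ≠ α) (z : ζ) (h : R ⊆ R') :
    C.count α z R β ≤ C.count α z R' β := by
  simp only [count, if_neg hβ]
  exact_mod_cast Finset.card_le_card (Finset.filter_subset_filter _ h)

variable [DecidableEq ι]

lemma count_insert {b : ι} {z : ζ} {β : κ} (hβ : β ∉ ({α, C.loc z b} : Finset κ)) :
    C.count α z (insert b R) β = C.count α z R β := by
  rw [Finset.mem_insert, Finset.mem_singleton, not_or] at hβ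
  simp only [count, if_neg hβ.1, Finset.filter_insert, if_neg (Ne.symm hβ.2)]

section Law

variable {Ω : Type*} [MeasurableSpace Ω] {P : Measure Ω} {M : κ → Ω → ℕ}

lemma Represents.setIntegral_eq (hC : C.Represents α P M) (hM : ∀ β, Measurable (M β))
    (D : ℤ → Prop) [DecidablePred D] (Φ : (κ → ℤ) → ℝ) :
    ∫ ω in {ω | D (M α ω)}, Φ (fun β => M β ω) ∂P =
      C.sum fun R => if D (C.T - R.card) then C.avg α Φ R else 0 := by
  rw [← integral_indicator (measurableSet_count hM D α)]
  simp only [← avg_ite]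
  rw [← hC fun v => if D (v α) then Φ v else 0]
  simp only [Set.indicator_apply, Set.mem_ofPred_eq]

lemma Represents.measureReal_eq (hC : C.Represents α P M) (hM : ∀ β, Measurable (M β))
    (D : ℤ → Prop) [DecidablePred D] :
    P.real {ω | D (M α ω)} = C.sum fun R => if D (C.T - R.card) then 1 else 0 := by
  have h := hC.setIntegral_eq hM D fun _ => 1
  simpa only [setIntegral_const, smul_eq_mul, mul_one, avg_const] using h

lemma Represents.sum_one [IsProbabilityMeasure P] (hC : C.Represents α P M) :
    C.sum (fun _ => 1) = 1 := by
  have h := hC fun _ => 1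
  simpa only [integral_const, probReal_univ, smul_eq_mul, mul_one, avg_const] using h.symm

lemma Represents.measureReal_eq_mass (hC : C.Represents α P M) (hM : ∀ β, Measurable (M β))
    (k : ℤ) : P.real {ω | (M α ω : ℤ) = k} = C.mass (C.T - k) := by
  rw [hC.measureReal_eq hM (· = k), TiltedBernoulli.sum, TiltedBernoulli.mass, levelWeight,
    levelSum, Finset.sum_filter, Finset.mul_sum]
  refine Finset.sum_congr rfl fun R _ => ?_
  by_cases h : (R.card : ℤ) = C.T - k
  · rw [if_pos (by lia), if_pos h, h]
  · rw [if_neg (by lia), if_neg h, mul_zero, mul_zero, mul_zero]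

lemma Represents.dominatedGiven [IsProbabilityMeasure P] (hC : C.Represents α P M)
    (hM : ∀ β, Measurable (M β)) {Y : (κ → ℤ) → ℝ} {c : ℝ} (D : ℤ → Prop) [DecidablePred D]
    (h : ∀ F : ℝ → ℝ, Monotone F →
      C.sum (fun R => if D (C.T - R.card) then C.avg α (fun v => F (Y v)) R else 0) *
          C.sum (fun _ => 1) ≤
        C.sum (fun R => if D (C.T - R.card) then 1 else 0) *
          C.sum (C.avg α fun v => F (Y v + c))) :
    DominatedGiven P (fun ω => Y fun β => M β ω) {ω | D (M α ω)} c := by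
  intro F hF
  rw [hC.setIntegral_eq hM D fun v => F (Y v), hC.measureReal_eq hM D, hC fun v => F (Y v + c)]
  simpa only [hC.sum_one, mul_one] using h F hF

variable [IsProbabilityMeasure P] [Fintype κ] {w : κ → ℝ} {c : ℝ}

theorem Represents.dominatedGiven_ge (hC : C.Represents α P M) (hM : ∀ β, Measurable (M β))
    (hw : ∀ β, 0 ≤ w β) (hwc : w α ≤ c) (d : κ → ℤ) :
    DominatedGiven P (indicatorSum w fun β => {ω | d β ≤ M β ω}) {ω | d α ≤ M α ω} c := by
  refine hC.dominatedGiven hM (Y := indicatorSum w fun β => {v | d β ≤ v β}) (d α ≤ ·) fun F hF =>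
    C.sum_lowerSet_mul_sum_le (D := fun r => d α ≤ C.T - r) (fun r r' hr h => ?_)
      fun R R' hRR' _ => avg_le_avg fun z => hF ?_
  · exact h.trans (sub_le_sub_left hr _)
  · refine (indicatorSum_le_add_sum hw {α} fun β hβ h => ?_).trans
      (add_le_add_right ((Finset.sum_singleton w α).trans_le hwc) _)
    exact h.trans (count_mono (Finset.notMem_singleton.1 hβ) z hRR')

theorem Represents.dominatedGiven_ne (hC : C.Represents α P M) (hM : ∀ β, Measurable (M β))
    (hw : ∀ β, 0 ≤ w β) (hwc : ∀ β, w β ≤ c) (d : κ → ℤ) :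
    DominatedGiven P (indicatorSum w fun β => {ω | (M β ω : ℤ) ≠ d β}) {ω | (M α ω : ℤ) ≠ d α}
      (2 * c) := by
  have hc : 0 ≤ c := (hw α).trans (hwc α)
  have hpair (b : κ) : ∑ β ∈ {α, b}, w β ≤ 2 * c :=
    (Finset.sum_le_card_nsmul _ _ c fun β _ => hwc β).trans <| by
      rw [nsmul_eq_mul]
      exact mul_le_mul_of_nonneg_right (mod_cast Finset.card_le_two) hc
  have hshift (r : ℤ) : C.T - r ≠ d α ↔ r ≠ C.T - d α := by lia
  refine hC.dominatedGiven hM (Y := indicatorSum w fun β => {v | v β ≠ d β}) (· ≠ d α)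
    fun F hF => ?_
  simp only [hshift]
  refine C.sum_ne_mul_sum_le (C.T - d α)
    (fun R _ => avg_le_avg fun z => hF (le_add_of_nonneg_right (by positivity)))
    fun b R _ _ => ⟨avg_le_avg fun z => hF ?_, avg_le_avg fun z => hF ?_⟩
  all_goals
    refine (indicatorSum_le_add_sum hw {α, C.loc z b} fun β hβ h => ?_).trans
      (add_le_add_right (hpair _) _)
    simpa only [Set.mem_ofPred_eq, count_insert hβ] using h

end Law

end ColorSplit

section Thresholds

variable {m : ℕ} {w : Fin m → ℝ}

lemma le_maxWeight (w : Fin m → ℝ) (α : Fin m) : w α ≤ maxWeight w :=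
  le_ciSup (Set.finite_range w).bddAbove α

lemma maxWeight_pos {q : Fin m → ℝ} (hq : ∀ α, 0 ≤ q α) (h : 0 < ∑ α, w α * q α) :
    0 < maxWeight w := by
  by_contra! hle
  exact h.not_ge <| Finset.sum_nonpos fun α _ =>
    mul_nonpos_of_nonpos_of_nonneg ((le_maxWeight w α).trans hle) (hq α)

variable {Ω : Type*} {M : Fin m → Ω → ℕ} {d : Fin m → ℤ}

lemma Yge_eq_indicatorSum : Yge w d M = indicatorSum w fun α => {ω | d α ≤ M α ω} := by
  funext ω
  simp [Yge, indicatorSum, Set.indicator_apply]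

lemma Yne_eq_indicatorSum : Yne w d M = indicatorSum w fun α => {ω | (M α ω : ℤ) ≠ d α} := by
  funext ω
  simp [Yne, indicatorSum, Set.indicator_apply]

variable [MeasurableSpace Ω] {P : Measure Ω} [IsProbabilityMeasure P]

lemma integral_Yge (hM : ∀ α, Measurable (M α)) (w : Fin m → ℝ) (d : Fin m → ℤ) :
    ∫ ω, Yge w d M ω ∂P = ∑ α, w α * P.real {ω | d α ≤ M α ω} := by
  rw [Yge_eq_indicatorSum]
  exact integral_indicatorSum w fun α => measurableSet_count hM (d α ≤ ·) α

lemma integral_Yne (hM : ∀ α, Measurable (M α)) (w : Fin m → ℝ) (d : Fin m → ℤ) :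
    ∫ ω, Yne w d M ω ∂P = ∑ α, w α * P.real {ω | (M α ω : ℤ) ≠ d α} := by
  rw [Yne_eq_indicatorSum]
  exact integral_indicatorSum w fun α => measurableSet_count hM (· ≠ d α) α

variable {ι ζ : Type*} [Fintype ζ] [DecidableEq ι] {C : Fin m → ColorSplit ι ζ (Fin m)}

theorem concentrationBounds_Yge (hC : ∀ α, (C α).Represents α P M) (hM : ∀ α, Measurable (M α))
    (hw : ∀ α, 0 ≤ w α) (hμ : 0 < ∫ ω, Yge w d M ω ∂P) :
    ConcentrationBounds P (Yge w d M) (∫ ω, Yge w d M ω ∂P) (maxWeight w) := by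
  have hpos : 0 < maxWeight w := by
    rw [integral_Yge hM] at hμ
    exact maxWeight_pos (fun _ => measureReal_nonneg) hμ
  rw [Yge_eq_indicatorSum] at hμ ⊢
  exact concentrationBounds_indicatorSum hw (fun α => measurableSet_count hM (d α ≤ ·) α) hμ hpos
    fun α => (hC α).dominatedGiven_ge hM hw (le_maxWeight w α) d

theorem concentrationBounds_Yne (hC : ∀ α, (C α).Represents α P M) (hM : ∀ α, Measurable (M α))
    (hw : ∀ α, 0 ≤ w α) (hμ : 0 < ∫ ω, Yne w d M ω ∂P) :
    ConcentrationBounds P (Yne w d M) (∫ ω, Yne w d M ω ∂P) (2 * maxWeight w) := by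
  have hpos : 0 < maxWeight w := by
    rw [integral_Yne hM] at hμ
    exact maxWeight_pos (fun _ => measureReal_nonneg) hμ
  rw [Yne_eq_indicatorSum] at hμ ⊢
  exact concentrationBounds_indicatorSum hw (fun α => measurableSet_count hM (· ≠ d α) α) hμ
    (by positivity) fun α => (hC α).dominatedGiven_ne hM hw (le_maxWeight w) d

end Thresholds

/-! ### Color splits of the multinomial model -/

lemma integral_comp_eq_sum {Ω E : Type*} [MeasurableSpace Ω] {P : Measure Ω} [IsFiniteMeasure P]
    [Fintype E] [MeasurableSpace E] [MeasurableSingletonClass E] {X : Ω → E} (hX : Measurable X)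
    (f : E → ℝ) : ∫ ω, f (X ω) ∂P = ∑ e, P.real (X ⁻¹' {e}) * f e := by
  rw [← integral_map hX.aemeasurable (.of_discrete (f := f)), integral_fintype .of_finite]
  simp only [map_measureReal_apply hX (measurableSet_singleton _), smul_eq_mul]

lemma sum_prod_mul_comp {ι κ κ' : Type*} [Fintype ι] [Fintype κ] [Fintype κ'] [DecidableEq ι]
    [DecidableEq κ] (g : ι → κ' → ℝ) (e : ι → κ' → κ) (F : (ι → κ) → ℝ) :
    ∑ t : ι → κ', (∏ i, g i (t i)) * F (fun i => e i (t i)) =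
      ∑ l : ι → κ, (∏ i, ∑ c with e i c = l i, g i c) * F l := by
  rw [← Finset.sum_fiberwise Finset.univ fun t i => e i (t i)]
  refine Finset.sum_congr rfl fun l _ => ?_
  rw [Finset.prod_univ_sum, Finset.sum_mul]
  refine Finset.sum_congr (by ext; simp [funext_iff]) fun t ht => ?_
  rw [funext fun i => (Finset.mem_filter.1 (Fintype.mem_piFinset.1 ht i)).2]

lemma prod_mul_add_mul_eq_sum {ι : Type*} [DecidableEq ι] (s : Finset ι) (x y u v : ι → ℝ) :
    ∏ i ∈ s, (x i * u i + y i * v i) =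
      ∑ R ∈ s.powerset, subsetWeight s x y R * subsetWeight s u v R := by
  rw [Finset.prod_add]
  refine Finset.sum_congr rfl fun R _ => ?_
  rw [Finset.prod_mul_distrib, Finset.prod_mul_distrib, subsetWeight, subsetWeight,
    mul_mul_mul_comm]

section CondLoc

lemma le_one_of_sum_eq_one {κ : Type*} [Fintype κ] {p : κ → ℝ} (hp : ∀ β, 0 ≤ p β)
    (hsum : ∑ β, p β = 1) (α : κ) : p α ≤ 1 :=
  hsum ▸ Finset.single_le_sum (fun β _ => hp β) (Finset.mem_univ α)

variable {κ : Type*} [DecidableEq κ] {p : κ → ℝ} {α : κ}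

/-- The law `p` conditioned on differing from `α`. The value `p` in the degenerate case `p α = 1`
makes this a probability vector. -/
def condLoc (p : κ → ℝ) (α : κ) : κ → ℝ :=
  if p α = 1 then p else fun β => Function.update p α 0 β / (1 - p α)

lemma one_sub_mul_condLoc_self : (1 - p α) * condLoc p α α = 0 := by
  by_cases h : p α = 1 <;> simp [condLoc, h]

variable [Fintype κ]

lemma condLoc_nonneg (hp : ∀ β, 0 ≤ p β) (hsum : ∑ β, p β = 1) (β : κ) : 0 ≤ condLoc p α β := by
  have h1 := le_one_of_sum_eq_one hp hsum α
  unfold condLoc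
  split_ifs
  · exact hp β
  · refine div_nonneg ?_ (sub_nonneg.2 h1)
    by_cases hβ : β = α <;> simp [hβ, hp]

lemma sum_condLoc (hsum : ∑ β, p β = 1) : ∑ β, condLoc p α β = 1 := by
  unfold condLoc
  split_ifs with h
  · exact hsum
  · rw [← Finset.sum_div, Finset.sum_update_of_mem (Finset.mem_univ α), zero_add,
      div_eq_one_iff_eq (sub_ne_zero.2 (Ne.symm h)), ← hsum,
      ← Finset.sum_sdiff (Finset.subset_univ {α}), Finset.sum_singleton, add_sub_cancel_right]

lemma one_sub_mul_condLoc_add (hp : ∀ β, 0 ≤ p β) (hsum : ∑ β, p β = 1) (β : κ) :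
    (1 - p α) * condLoc p α β + p α * (if β = α then 1 else 0) = p β := by
  by_cases hβ : β = α
  · subst hβ
    rw [one_sub_mul_condLoc_self, if_pos rfl, zero_add, mul_one]
  rw [if_neg hβ, mul_zero, add_zero]
  by_cases h : p α = 1
  · have hle := Finset.add_le_sum (fun β _ => hp β) (Finset.mem_univ α) (Finset.mem_univ β)
      (Ne.symm hβ)
    have hzero : p β = 0 := le_antisymm (by linarith) (hp β)
    simp [h, hzero]
  · rw [condLoc, if_neg h, Function.update_of_ne hβ,
      mul_div_cancel₀ _ (sub_ne_zero.2 (Ne.symm h))]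

end CondLoc

section Multinomial

variable {m n : ℕ} {p : Fin m → Fin n → ℝ} {α : Fin m}

/-- The occupancy model as seen from urn `α`: `R` is the set of balls outside of urn `α`, and
`z j` is the urn that ball `j` takes if it is one of these. -/
def multinomialSplit (hp : ∀ β j, 0 ≤ p β j) (hsum : ∀ j, ∑ β, p β j = 1) (α : Fin m) :
    ColorSplit (Fin n) (Fin n → Fin m) (Fin m) where
  support := Finset.univ
  x j := 1 - p α j
  y j := p α j
  a _ := 1
  T := n
  ρ z := ∏ j, condLoc (p · j) α (z j)
  loc z := z
  x_nonneg j _ := sub_nonneg.2 (le_one_of_sum_eq_one (hp · j) (hsum j) α)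
  y_nonneg j _ := hp α j
  a_nonneg _ := zero_le_one
  isLogConcave_a := isLogConcave_const 1
  ρ_nonneg z := Finset.prod_nonneg fun j _ => condLoc_nonneg (hp · j) (hsum j) _
  sum_ρ := by
    rw [← Fintype.prod_sum fun j β => condLoc (p · j) α β]
    exact Finset.prod_eq_one fun j _ => sum_condLoc (hsum j)

lemma sum_prod_condLoc_mul_piecewise (hsum : ∀ j, ∑ β, p β j = 1) (R : Finset (Fin n))
    (F : (Fin n → Fin m) → ℝ) :
    ∑ z : Fin n → Fin m, (∏ j, condLoc (p · j) α (z j)) * F (R.piecewise z fun _ => α) =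
      ∑ l : Fin n → Fin m, subsetWeight Finset.univ (fun j => condLoc (p · j) α (l j))
        (fun j => if l j = α then 1 else 0) R * F l := by
  have h := sum_prod_mul_comp (fun j c => condLoc (p · j) α c)
    (fun j c => if j ∈ R then c else α) F
  refine h.trans (Finset.sum_congr rfl fun l _ => ?_)
  congr 1
  rw [subsetWeight, ← Finset.prod_sdiff (Finset.subset_univ R), mul_comm]
  congr 1 <;> refine Finset.prod_congr rfl fun j hj => ?_
  · simp [hj, Finset.filter_eq']
  · simp only [if_neg (Finset.mem_sdiff.1 hj).2, Finset.sum_filter]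
    by_cases hlj : l j = α
    · simp [hlj, sum_condLoc (hsum j)]
    · simp [hlj, Ne.symm hlj]

lemma card_filter_piecewise_eq_count (hp : ∀ β j, 0 ≤ p β j) (hsum : ∀ j, ∑ β, p β j = 1)
    {R : Finset (Fin n)} {z : Fin n → Fin m} (hz : ∀ j ∈ R, z j ≠ α) (β : Fin m) :
    ({j | R.piecewise z (fun _ => α) j = β} : Finset (Fin n)).card =
      (multinomialSplit hp hsum α).count α z R β := by
  by_cases hβ : β = α
  · have hcompl : ({j | R.piecewise z (fun _ => α) j = α} : Finset (Fin n)) = Rᶜ := by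
      ext j
      by_cases hj : j ∈ R <;> simp [hj, hz]
    rw [ColorSplit.count, if_pos hβ, hβ, hcompl, Finset.card_compl, Fintype.card_fin,
      Nat.cast_sub ((Finset.card_le_univ R).trans_eq (Fintype.card_fin n)), multinomialSplit]
  · rw [ColorSplit.count, if_neg hβ]
    congr 2
    ext j
    rw [Finset.mem_filter_univ, Finset.mem_filter, multinomialSplit]
    by_cases hj : j ∈ R <;> simp [hj, Ne.symm hβ]

lemma subsetWeight_mul_prod_condLoc_eq_zero {R : Finset (Fin n)} {z : Fin n → Fin m} {j : Fin n}
    (hj : j ∈ R) (hzj : z j = α) :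
    subsetWeight Finset.univ (fun j => 1 - p α j) (p α) R *
      ∏ j, condLoc (p · j) α (z j) = 0 := by
  have hR : (∏ j ∈ R, (1 - p α j)) * ∏ j ∈ R, condLoc (p · j) α (z j) = 0 := by
    rw [← Finset.prod_mul_distrib]
    exact Finset.prod_eq_zero hj <| hzj ▸ one_sub_mul_condLoc_self (p := (p · j))
  rw [subsetWeight, ← Finset.prod_sdiff (Finset.subset_univ R)]
  linear_combination (∏ j ∈ Finset.univ \ R, p α j) *
    (∏ j ∈ Finset.univ \ R, condLoc (p · j) α (z j)) * hR

lemma sum_prod_mul_eq_sum (hp : ∀ β j, 0 ≤ p β j) (hsum : ∀ j, ∑ β, p β j = 1) (α : Fin m)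
    (Φ : (Fin m → ℤ) → ℝ) :
    ∑ l : Fin n → Fin m, (∏ j, p (l j) j) * Φ (fun β => ({j | l j = β} : Finset (Fin n)).card) =
      (multinomialSplit hp hsum α).sum ((multinomialSplit hp hsum α).avg α Φ) := by
  set x := fun j => 1 - p α j with hx
  set F : (Fin n → Fin m) → ℝ := fun l => Φ fun β => ({j | l j = β} : Finset (Fin n)).card
  have hprod (l : Fin n → Fin m) : ∏ j, p (l j) j =
      ∑ R ∈ (Finset.univ : Finset (Fin n)).powerset, subsetWeight Finset.univ x (p α) R *
        subsetWeight Finset.univ (fun j => condLoc (p · j) α (l j))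
          (fun j => if l j = α then 1 else 0) R := by
    rw [← prod_mul_add_mul_eq_sum]
    exact Finset.prod_congr rfl fun j _ =>
      (one_sub_mul_condLoc_add (hp · j) (hsum j) (l j)).symm
  have hcount (R : Finset (Fin n)) (z : Fin n → Fin m) :
      subsetWeight Finset.univ x (p α) R * ((∏ j, condLoc (p · j) α (z j)) *
        F (R.piecewise z fun _ => α)) =
      subsetWeight Finset.univ x (p α) R * ((∏ j, condLoc (p · j) α (z j)) *
        Φ ((multinomialSplit hp hsum α).count α z R)) := by
    by_cases hz : ∀ j ∈ R, z j ≠ α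
    · simp only [F, card_filter_piecewise_eq_count hp hsum hz]
    · push Not at hz
      obtain ⟨j, hj, hzj⟩ := hz
      simp only [← mul_assoc, hx, subsetWeight_mul_prod_condLoc_eq_zero hj hzj, zero_mul]
  simp only [hprod, Finset.sum_mul]
  rw [Finset.sum_comm]
  refine Finset.sum_congr rfl fun R _ => ?_
  simp only [mul_assoc]
  rw [← Finset.mul_sum, ← sum_prod_condLoc_mul_piecewise hsum R F, Finset.mul_sum]
  simp only [hcount]
  rw [← Finset.mul_sum]
  exact (one_mul _).symm

lemma pbEq_eq_mass (hp : ∀ β j, 0 ≤ p β j) (hsum : ∀ j, ∑ β, p β j = 1) (α : Fin m) (k : ℤ) :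
    pbEq k (p α) = (multinomialSplit hp hsum α).mass (n - k) := by
  simp only [TiltedBernoulli.mass, multinomialSplit, levelWeight, levelSum, subsetWeight, one_mul,
    mul_one, Finset.powerset_univ, pbEq]
  have hcard (s : Finset (Fin n)) : s.card + sᶜ.card = n :=
    (Finset.card_add_card_compl s).trans (Fintype.card_fin n)
  refine Finset.sum_bij' (fun s _ => sᶜ) (fun s _ => sᶜ) (fun s hs => ?_) (fun s hs => ?_)
    (fun s _ => compl_compl s) (fun s _ => compl_compl s) fun s _ => ?_
  iterate 2
    rw [Finset.mem_filter_univ] at hs ⊢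
    have := hcard s
    lia
  rw [← Finset.compl_eq_univ_sdiff, compl_compl, mul_comm]

namespace IsMultinomialOccupancy

variable {Ω : Type*} [MeasurableSpace Ω] {P : Measure Ω} {L : Fin n → Ω → Fin m}

lemma measurable_loc (h : IsMultinomialOccupancy P p L) : Measurable fun ω j => L j ω :=
  measurable_pi_lambda _ h.measurable

lemma measureReal_preimage_singleton (h : IsMultinomialOccupancy P p L) (l : Fin n → Fin m) :
    P.real ((fun ω j => L j ω) ⁻¹' {l}) = ∏ j, p (l j) j := by
  have hinter : (fun ω j => L j ω) ⁻¹' {l} = ⋂ j ∈ Finset.univ, L j ⁻¹' {l j} := by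
    ext ω
    simp [funext_iff]
  rw [hinter, measureReal_def, h.indep.measure_inter_preimage_eq_mul Finset.univ
    fun j _ => MeasurableSet.singleton _, ENNReal.toReal_prod]
  exact Finset.prod_congr rfl fun j _ => h.law (l j) j

lemma nonneg (h : IsMultinomialOccupancy P p L) (β : Fin m) (j : Fin n) : 0 ≤ p β j :=
  h.law β j ▸ measureReal_nonneg

lemma measurable_urnCount (h : IsMultinomialOccupancy P p L) (α : Fin m) :
    Measurable (urnCount L α) :=
  (measurable_of_finite fun l : Fin n → Fin m =>
    ({j | l j = α} : Finset (Fin n)).card).comp h.measurable_loc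

variable [IsProbabilityMeasure P]

lemma sum_eq_one (h : IsMultinomialOccupancy P p L) (j : Fin n) : ∑ β, p β j = 1 := by
  have hlaw := integral_comp_eq_sum (P := P) (h.measurable j) fun _ => 1
  rw [integral_const, probReal_univ, one_smul] at hlaw
  rw [hlaw]
  exact Finset.sum_congr rfl fun β _ => ((mul_one _).trans (h.law β j)).symm

theorem represents (h : IsMultinomialOccupancy P p L) (α : Fin m) :
    (multinomialSplit h.nonneg h.sum_eq_one α).Represents α P (urnCount L) := fun Φ => by
  rw [← sum_prod_mul_eq_sum h.nonneg h.sum_eq_one α Φ]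
  simp only [← h.measureReal_preimage_singleton]
  exact integral_comp_eq_sum h.measurable_loc
    fun l => Φ fun β => ({j | l j = β} : Finset (Fin n)).card

lemma measureReal_urnCount_eq (h : IsMultinomialOccupancy P p L) (α : Fin m) (k : ℤ) :
    P.real {ω | (urnCount L α ω : ℤ) = k} = pbEq k (p α) := by
  rw [pbEq_eq_mass h.nonneg h.sum_eq_one α]
  exact (h.represents α).measureReal_eq_mass h.measurable_urnCount k

theorem integral_Yge (h : IsMultinomialOccupancy P p L) (w : Fin m → ℝ) (d : Fin m → ℤ) :
    ∫ ω, Yge w d (urnCount L) ω ∂P = multinomialMeanGe w d p := by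
  rw [Occupancy.integral_Yge h.measurable_urnCount]
  refine Finset.sum_congr rfl fun α _ => congrArg (w α * ·) ?_
  have hset : {ω | d α ≤ urnCount L α ω} =
      (fun ω => (urnCount L α ω : ℤ)) ⁻¹' (Finset.Icc (d α) n : Finset ℤ) := by
    ext ω
    have hle : urnCount L α ω ≤ n := (Finset.card_le_univ _).trans_eq (Fintype.card_fin n)
    simp [hle]
  rw [hset, ← sum_measureReal_preimage_singleton (Finset.Icc (d α) n)
    fun k _ => measurableSet_count h.measurable_urnCount (· = k) α]
  exact Finset.sum_congr rfl fun k _ => h.measureReal_urnCount_eq α k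

theorem integral_Yne (h : IsMultinomialOccupancy P p L) (w : Fin m → ℝ) (d : Fin m → ℤ) :
    ∫ ω, Yne w d (urnCount L) ω ∂P = multinomialMeanNe w d p := by
  rw [Occupancy.integral_Yne h.measurable_urnCount]
  refine Finset.sum_congr rfl fun α _ => congrArg (w α * ·) ?_
  rw [pbNe, ← h.measureReal_urnCount_eq]
  exact probReal_compl_eq_one_sub (measurableSet_count h.measurable_urnCount (· = d α) α)

end IsMultinomialOccupancy

end Multinomial

/-! ### Color splits of the hypergeometric model -/

lemma sum_finset_eq_sum_powerset_filter {ι : Type*} [Fintype ι] [DecidableEq ι] (q : ι → Prop)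
    [DecidablePred q] (F : Finset ι → ℝ) :
    ∑ B : Finset ι, F B =
      ∑ R ∈ ({b | ¬q b} : Finset ι).powerset, ∑ A ∈ ({b | q b} : Finset ι).powerset, F (A ∪ R) := by
  rw [← Finset.sum_product']
  refine Finset.sum_nbij' (fun B => (B.filter fun b => ¬q b, B.filter q)) (fun x => x.2 ∪ x.1)
    (fun B _ => ?_) (fun _ _ => Finset.mem_univ _)
    (fun B _ => Finset.filter_union_filter_not_eq q B) ?_
    (fun B _ => by rw [Finset.filter_union_filter_not_eq q B])
  · simp only [Finset.mem_product, Finset.mem_powerset]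
    exact ⟨Finset.filter_subset_filter _ (Finset.subset_univ B),
      Finset.filter_subset_filter _ (Finset.subset_univ B)⟩
  · rintro ⟨R, A⟩ h
    simp only [Finset.mem_product, Finset.mem_powerset, Finset.subset_iff,
      Finset.mem_filter_univ] at h
    ext b <;> simp only [Finset.mem_filter, Finset.mem_union] <;> grind

lemma levelWeight_one_eq_choose {ι : Type*} [DecidableEq ι] (s : Finset ι) (k : ℕ) :
    levelWeight s (fun _ => 1) (fun _ => 1) k = s.card.choose k := by
  rw [← Finset.card_powersetCard, Finset.powersetCard_eq_filter]
  simp [levelWeight, levelSum, subsetWeight]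

section Hypergeometric

variable {m : ℕ} {N : Fin m → ℕ} {s : ℕ} {α : Fin m}

lemma card_filter_color_eq (N : Fin m → ℕ) (α : Fin m) :
    ({b | b.1 = α} : Finset (Ball N)).card = N α := by
  have hmap : ({b | b.1 = α} : Finset (Ball N)) =
      Finset.univ.map (Function.Embedding.sigmaMk α) := by
    ext ⟨β, i⟩
    aesop
  rw [hmap, Finset.card_map, Finset.card_univ, Fintype.card_fin]

lemma card_filter_color_ne (N : Fin m → ℕ) (α : Fin m) :
    ({b | ¬b.1 = α} : Finset (Ball N)).card = (∑ β, N β) - N α := by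
  have hcard := Finset.card_filter_add_card_filter_not (s := (Finset.univ : Finset (Ball N)))
    fun b => b.1 = α
  rw [card_filter_color_eq, Finset.card_univ, Fintype.card_sigma] at hcard
  simp only [Fintype.card_fin] at hcard
  lia

/-- The hypergeometric model as seen from color `α`: `R` is the set of sampled balls of another
color. It completes to a sample in as many ways as there are sets of `s - R.card` balls of
color `α`. -/
def hypergeometricSplit (N : Fin m → ℕ) (s : ℕ) (α : Fin m) :
    ColorSplit (Ball N) Unit (Fin m) where
  support := {b | ¬b.1 = α}
  x _ := 1
  y _ := 1
  a r := 1 / (∑ β, N β).choose s *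
    levelWeight ({b | b.1 = α} : Finset (Ball N)) (fun _ => 1) (fun _ => 1) (s - r)
  T := s
  ρ _ := 1
  loc _ b := b.1
  x_nonneg _ _ := zero_le_one
  y_nonneg _ _ := zero_le_one
  a_nonneg _ := mul_nonneg (by positivity)
    (levelWeight_nonneg (fun _ _ => zero_le_one) (fun _ _ => zero_le_one) _)
  isLogConcave_a := (isLogConcave_const _).mul
    ((isLogConcave_levelWeight (fun _ _ => zero_le_one) fun _ _ => zero_le_one).comp_sub_left s)
    (fun _ => by positivity)
    fun _ => levelWeight_nonneg (fun _ _ => zero_le_one) (fun _ _ => zero_le_one) _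
  ρ_nonneg _ := zero_le_one
  sum_ρ := by rw [Finset.sum_const, Finset.card_univ, Fintype.card_unit, one_smul]

lemma hyperQ_eq_mass {j : ℕ} (hj : j ≤ s) :
    hyperQ j (N α) s (∑ β, N β) = (hypergeometricSplit N s α).mass (s - j) := by
  have hN : N α ≤ ∑ β, N β :=
    Finset.single_le_sum (fun β _ => Nat.zero_le _) (Finset.mem_univ α)
  simp only [hyperQ, if_pos (And.intro hj hN), TiltedBernoulli.mass, hypergeometricSplit,
    sub_sub_cancel]
  rw [← Nat.cast_sub hj, levelWeight_one_eq_choose, levelWeight_one_eq_choose,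
    card_filter_color_eq, card_filter_color_ne]
  ring

lemma card_filter_union_eq_count {R A : Finset (Ball N)} (hR : ∀ b ∈ R, ¬b.1 = α)
    (hA : ∀ b ∈ A, b.1 = α) (h : (A.card : ℤ) = s - R.card) (β : Fin m) :
    ({b ∈ A ∪ R | b.1 = β}.card : ℤ) = (hypergeometricSplit N s α).count α () R β := by
  rw [Finset.filter_union, ColorSplit.count]
  by_cases hβ : β = α
  · rw [if_pos hβ, hβ, Finset.filter_true_of_mem hA, Finset.filter_false_of_mem hR,
      Finset.union_empty, h, hypergeometricSplit]
  · rw [if_neg hβ, Finset.filter_false_of_mem (s := A), Finset.empty_union, hypergeometricSplit]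
    exact fun b hb hbβ => hβ (hbβ.symm.trans (hA b hb))

lemma sum_card_eq_mul_eq_sum (N : Fin m → ℕ) (s : ℕ) (α : Fin m) (Φ : (Fin m → ℤ) → ℝ) :
    ∑ B : Finset (Ball N), (if B.card = s then 1 / ((∑ β, N β).choose s : ℝ) else 0) *
        Φ (fun β => {b ∈ B | b.1 = β}.card) =
      (hypergeometricSplit N s α).sum ((hypergeometricSplit N s α).avg α Φ) := by
  rw [sum_finset_eq_sum_powerset_filter fun b : Ball N => b.1 = α]
  refine Finset.sum_congr rfl fun R hR => ?_
  replace hR : ∀ b ∈ R, ¬b.1 = α := fun b hb =>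
    (Finset.mem_filter.1 (Finset.mem_powerset.1 hR hb)).2
  have havg : (hypergeometricSplit N s α).avg α Φ R =
      Φ ((hypergeometricSplit N s α).count α () R) := by
    simp [ColorSplit.avg, hypergeometricSplit]
  rw [havg]
  change _ = 1 / ((∑ β, N β).choose s : ℝ) *
    levelWeight ({b | b.1 = α} : Finset (Ball N)) (fun _ => 1) (fun _ => 1) (s - R.card) *
      (subsetWeight _ (fun _ => 1) (fun _ => 1) R * _)
  simp only [levelWeight, levelSum, subsetWeight, Finset.prod_const_one, one_mul, mul_one,
    Finset.sum_filter, Finset.mul_sum, Finset.sum_mul]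
  refine Finset.sum_congr rfl fun A hA => ?_
  replace hA : ∀ b ∈ A, b.1 = α := fun b hb =>
    (Finset.mem_filter.1 (Finset.mem_powerset.1 hA hb)).2
  have hdisj : Disjoint A R := Finset.disjoint_left.2 fun b hb hb' => hR b hb' (hA b hb)
  rw [Finset.card_union_of_disjoint hdisj]
  by_cases h : A.card + R.card = s
  · have h' : (A.card : ℤ) = s - R.card := by lia
    simp only [if_pos h, if_pos h', card_filter_union_eq_count hR hA h', mul_one]
  · rw [if_neg h, if_neg (by lia), mul_zero, zero_mul, zero_mul]

namespace IsHypergeometricSample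

variable {Ω : Type*} [MeasurableSpace Ω] {P : Measure Ω} {S : Ω → Finset (Ball N)}

lemma measurable_colorCount (h : IsHypergeometricSample P N s S) (α : Fin m) :
    Measurable (colorCount S α) := by
  let _ : MeasurableSpace (Finset (Ball N)) := ⊤
  exact (measurable_from_top (f := fun B : Finset (Ball N) => {b ∈ B | b.1 = α}.card)).comp
    (measurable_to_countable' h.measurable)

variable [IsProbabilityMeasure P]

lemma ae_card_eq (h : IsHypergeometricSample P N s S) : ∀ᵐ ω ∂P, (S ω).card = s := by
  have hset : {ω | (S ω).card = s} =
      S ⁻¹' (Finset.powersetCard s (Finset.univ : Finset (Ball N)) : Set (Finset (Ball N))) := by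
    ext ω
    simp
  have hfiber : ∀ B ∈ Finset.powersetCard s (Finset.univ : Finset (Ball N)),
      MeasurableSet (S ⁻¹' {B}) := fun B _ => h.measurable B
  have hmeas : MeasurableSet {ω | (S ω).card = s} := by
    rw [hset, ← Set.biUnion_preimage_singleton]
    exact Finset.measurableSet_biUnion _ hfiber
  have hlaw : ∀ B ∈ Finset.powersetCard s (Finset.univ : Finset (Ball N)),
      P.real (S ⁻¹' {B}) = 1 / ((∑ α, N α).choose s : ℝ) := fun B hB =>
    h.law B (Finset.mem_powersetCard.1 hB).2
  have hprob : P.real {ω | (S ω).card = s} = 1 := by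
    rw [hset, ← sum_measureReal_preimage_singleton _ hfiber, Finset.sum_congr rfl hlaw,
      Finset.sum_const, Finset.card_powersetCard, Finset.card_univ, Fintype.card_sigma,
      nsmul_eq_mul]
    simp only [Fintype.card_fin]
    exact mul_one_div_cancel (mod_cast (Nat.choose_pos h.size_le).ne')
  exact (mem_ae_iff_prob_eq_one hmeas).2 ((ENNReal.toReal_eq_one_iff _).1 hprob)

lemma measureReal_eq (h : IsHypergeometricSample P N s S) (B : Finset (Ball N)) :
    P.real {ω | S ω = B} = if B.card = s then 1 / ((∑ α, N α).choose s : ℝ) else 0 := by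
  split_ifs with hB
  · exact h.law B hB
  · rw [measureReal_eq_zero_iff]
    exact measure_mono_null (fun ω hω hcard => hB (hω ▸ hcard)) h.ae_card_eq

theorem represents (h : IsHypergeometricSample P N s S) (α : Fin m) :
    (hypergeometricSplit N s α).Represents α P (colorCount S) := fun Φ => by
  let _ : MeasurableSpace (Finset (Ball N)) := ⊤
  rw [← sum_card_eq_mul_eq_sum]
  simp only [← h.measureReal_eq]
  exact integral_comp_eq_sum (P := P) (measurable_to_countable' h.measurable)
    fun B => Φ fun β => {b ∈ B | b.1 = β}.card

lemma measureReal_colorCount (h : IsHypergeometricSample P N s S) (α : Fin m) (D : ℤ → Prop)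
    [DecidablePred D] : P.real {ω | D (colorCount S α ω)} =
      ∑ j ∈ Finset.range (s + 1) with D ((j : ℕ) : ℤ), hyperQ j (N α) s (∑ β, N β) := by
  have hae : {ω | D (colorCount S α ω)} =ᵐ[P]
      colorCount S α ⁻¹' ({j ∈ Finset.range (s + 1) | D ((j : ℕ) : ℤ)} : Finset ℕ) := by
    filter_upwards [h.ae_card_eq] with ω hω
    have hle : colorCount S α ω < s + 1 :=
      Nat.lt_succ_of_le ((Finset.card_filter_le _ _).trans_eq hω)
    exact propext ⟨fun hD => Finset.mem_filter.2 ⟨Finset.mem_range.2 hle, hD⟩,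
      fun hD => (Finset.mem_filter.1 hD).2⟩
  rw [measureReal_congr hae, ← sum_measureReal_preimage_singleton _ fun j _ =>
    h.measurable_colorCount α (measurableSet_singleton j)]
  refine Finset.sum_congr rfl fun j hj => ?_
  rw [hyperQ_eq_mass (Nat.lt_succ_iff.1 (Finset.mem_range.1 (Finset.mem_filter.1 hj).1))]
  have hpoint := (h.represents α).measureReal_eq_mass h.measurable_colorCount j
  simp only [Nat.cast_inj] at hpoint
  exact hpoint

theorem integral_Yge (h : IsHypergeometricSample P N s S) (w : Fin m → ℝ) (d : Fin m → ℤ) :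
    ∫ ω, Yge w d (colorCount S) ω ∂P = hyperMeanGe w d N s := by
  rw [Occupancy.integral_Yge h.measurable_colorCount]
  exact Finset.sum_congr rfl fun α _ =>
    congrArg (w α * ·) (h.measureReal_colorCount α (d α ≤ ·))

theorem integral_Yne (h : IsHypergeometricSample P N s S) (w : Fin m → ℝ) (d : Fin m → ℤ) :
    ∫ ω, Yne w d (colorCount S) ω ∂P = hyperMeanNe w d N s := by
  rw [Occupancy.integral_Yne h.measurable_colorCount]
  exact Finset.sum_congr rfl fun α _ =>
    congrArg (w α * ·) (h.measureReal_colorCount α (· ≠ d α))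

end IsHypergeometricSample

end Hypergeometric

end Occupancy

end

theorem theorem1p4 {Ω : Type*} [MeasurableSpace Ω] (P : Measure Ω) [IsProbabilityMeasure P]
    (m : ℕ) (w : Fin m → ℝ) (hw : ∀ α, 0 ≤ w α) (d : Fin m → ℤ) :
    -- multinomial occupancy
    (∀ (n : ℕ) (p : Fin m → Fin n → ℝ) (L : Fin n → Ω → Fin m),
      Occupancy.IsMultinomialOccupancy P p L →
        (∫ ω, Occupancy.Yge w d (Occupancy.urnCount L) ω ∂P = Occupancy.multinomialMeanGe w d p ∧
          (0 < Occupancy.multinomialMeanGe w d p →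
            Occupancy.ConcentrationBounds P (Occupancy.Yge w d (Occupancy.urnCount L))
              (Occupancy.multinomialMeanGe w d p) (Occupancy.maxWeight w))) ∧
        (∫ ω, Occupancy.Yne w d (Occupancy.urnCount L) ω ∂P = Occupancy.multinomialMeanNe w d p ∧
          (0 < Occupancy.multinomialMeanNe w d p →
            Occupancy.ConcentrationBounds P (Occupancy.Yne w d (Occupancy.urnCount L))
              (Occupancy.multinomialMeanNe w d p) (2 * Occupancy.maxWeight w)))) ∧
    -- multivariate hypergeometric sampling
    (∀ (N : Fin m → ℕ) (s : ℕ) (S : Ω → Finset (Occupancy.Ball N)),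
      Occupancy.IsHypergeometricSample P N s S →
        (∫ ω, Occupancy.Yge w d (Occupancy.colorCount S) ω ∂P = Occupancy.hyperMeanGe w d N s ∧
          (0 < Occupancy.hyperMeanGe w d N s →
            Occupancy.ConcentrationBounds P (Occupancy.Yge w d (Occupancy.colorCount S))
              (Occupancy.hyperMeanGe w d N s) (Occupancy.maxWeight w))) ∧
        (∫ ω, Occupancy.Yne w d (Occupancy.colorCount S) ω ∂P = Occupancy.hyperMeanNe w d N s ∧
          (0 < Occupancy.hyperMeanNe w d N s →
            Occupancy.ConcentrationBounds P (Occupancy.Yne w d (Occupancy.colorCount S))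
              (Occupancy.hyperMeanNe w d N s) (2 * Occupancy.maxWeight w)))) := by
  refine ⟨fun n p L h => ?_, fun N s S h => ?_⟩
  · refine ⟨⟨h.integral_Yge w d, fun hμ => ?_⟩, h.integral_Yne w d, fun hμ => ?_⟩
    · rw [← h.integral_Yge w d] at hμ ⊢
      exact Occupancy.concentrationBounds_Yge h.represents h.measurable_urnCount hw hμ
    · rw [← h.integral_Yne w d] at hμ ⊢
      exact Occupancy.concentrationBounds_Yne h.represents h.measurable_urnCount hw hμ
  · refine ⟨⟨h.integral_Yge w d, fun hμ => ?_⟩, h.integral_Yne w d, fun hμ => ?_⟩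
    · rw [← h.integral_Yge w d] at hμ ⊢
      exact Occupancy.concentrationBounds_Yge h.represents h.measurable_colorCount hw hμ
    · rw [← h.integral_Yne w d] at hμ ⊢
      exact Occupancy.concentrationBounds_Yne h.represents h.measurable_colorCount hw hμ
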